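/- Let $H(13,2)$ be the Hamming graph on the binary words of length $13$, two words being adjacent if they differ in exactly one position. For a nonempty set $C$ of vertices, let $C^{(i)}$ be the set of vertices at graph distance exactly $i$ from $C$. Call $C$ a $\{13,6,1;1,6,9\}$-CR code (a completely regular code with covering radius $3$ and this intersection array) if $C^{(0)},C^{(1)},C^{(2)},C^{(3)}$ are nonempty and partition the vertex set, for all $i,j\in\{0,1,2,3\}$ the number $S_{i,j}$ of neighbors in $C^{(j)}$ of a vertex of $C^{(i)}$ does not depend on the choice of that vertex, and $(S_{0,1},S_{1,2},S_{2,3})=(13,6,1)$, $(S_{1,0},S_{2,1},S_{3,2})=(1,6,9)$. Two codes are equivalent if one is obtained from the other by a permutation of the $13$ coordinates followed by a permutation of the symbols $\{0,1\}$ in each coordinate (in other words, by an automorphism of $H(13,2)$). Then $H(13,2)$ contains a $\{13,6,1;1,6,9\}$-CR code, and any two such codes are equivalent; that is, up to equivalence there is exactly one $\{13,6,1;1,6,9\}$-CR code in $H(13,2)$. -/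

import Mathlib

namespace CRCode

/-- The Hamming graph `H(n,q)`, the Cartesian product of `n` copies of the complete graph of
order `q`: two words are adjacent iff they differ in exactly one position. -/
def hammingGraph (n q : ℕ) : SimpleGraph (Fin n → Fin q) where
  Adj x y := hammingDist x y = 1
  symm := ⟨fun x y h => by rwa [hammingDist_comm]⟩
  loopless := ⟨fun x h => by simp at h⟩

/-- `(P 0, …, P (k-1))` is an equitable partition of the vertices of `G` into nonempty cells, with
quotient matrix `S`: every vertex of `P i` has exactly `S i j` neighbors in `P j`. -/
structure IsEquitablePartition {V : Type*} (G : SimpleGraph V) {k : ℕ} (P : Fin k → Set V)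
    (S : Matrix (Fin k) (Fin k) ℕ) : Prop where
  nonempty : ∀ i, (P i).Nonempty
  disjoint : Pairwise fun i j => Disjoint (P i) (P j)
  cover : ⋃ i, P i = Set.univ
  card_neighbors : ∀ i j, ∀ x ∈ P i, (G.neighborSet x ∩ P j).encard = S i j

/-- The cell `C^{(i)}` of the distance partition: the vertices at graph distance exactly `i`
from the set `C`. -/
def distanceCell {V : Type*} (G : SimpleGraph V) (C : Set V) (i : ℕ) : Set V :=
  {x | (⨅ c ∈ C, G.edist x c) = (i : ℕ∞)}

/-- `C` is a completely regular code in `G` with covering radius `ρ` and intersection array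
`{b 0, …, b (ρ-1); c 0, …, c (ρ-1)}`. The `c`-part is indexed from `0` here, so that `c i` is the
number of neighbors in `C^{(i)}` of a vertex of `C^{(i+1)}`. -/
def IsCRCode {V : Type*} (G : SimpleGraph V) {ρ : ℕ} (b c : Fin ρ → ℕ) (C : Set V) : Prop :=
  C.Nonempty ∧ ∃ S : Matrix (Fin (ρ + 1)) (Fin (ρ + 1)) ℕ,
    IsEquitablePartition G (fun i : Fin (ρ + 1) => distanceCell G C i) S ∧
    ∀ i : Fin ρ, S i.castSucc i.succ = b i ∧ S i.succ i.castSucc = c i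

/-- Equivalence of codes in `H(n,q)`: one is obtained from the other by a permutation of the
coordinates followed by a permutation of the alphabet in each coordinate. -/
def Equivalent {n q : ℕ} (C D : Set (Fin n → Fin q)) : Prop :=
  ∃ (π : Equiv.Perm (Fin n)) (σ : Fin n → Equiv.Perm (Fin q)),
    (fun (x : Fin n → Fin q) (i : Fin n) => σ i (x (π i))) '' C = D

end CRCode

/-
Uniqueness. The last cell is a disjoint union of subcubes of dimension 4. Such a subcube is a
ternary word of weight 9: its fixed symbols, read as `0 ↦ 1`, `1 ↦ -1`, and `0` at the free
coordinates. The intersection array determines how the cells are distributed over the shells around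
a subcube; hence the antipodal subcube is in the last cell, too, any two distinct subcubes are
at distance at least 3, and code words have distances divisible by 3 to the subcubes, which means
that, as words of signs, they are orthogonal to the ternary words. Double counting gives exactly 6
common nonzero positions for two independent ternary words, so these words and `0` form a linear
ternary code with 27 elements, the simplex code, whose coordinates represent the points of the
projective plane of order 3. A code word is therefore a word of signs in the dual of the simplex
code, the ternary Hamming code, and both sets have 288 elements. The ternary Hamming code is unique
up to permuting coordinates and changing their signs, which on binary words is an equivalence of
codes.

Existence. For the words of signs in a ternary Hamming code the delicate count is that of the
neighbors at distance 1 from the code of a word at distance at least 2. The columns of a parity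
check matrix, multiplied by the signs of that word, have a sum `s ≠ 0`. Projecting along `s` maps
the columns not on the line of `s` to pairs `±u` of nonzero vectors of a plane, and the sizes of the
fibers modulo 3, one for each of the four pairs, form a word of the tetracode, whose nonzero words
have weight 3.
-/

namespace CRCode

open Finset

section DistancePartition

variable {V : Type*} {G : SimpleGraph V} {C : Set V}

lemma distanceCell_zero (G : SimpleGraph V) (C : Set V) : distanceCell G C 0 = C := by
  ext x
  refine ⟨fun hx => ?_, fun hx => ?_⟩
  · have hlt : (⨅ z ∈ C, G.edist x z) < 1 := by
      rw [show (⨅ z ∈ C, G.edist x z) = ((0 : ℕ) : ℕ∞) from hx]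
      simp
    simp only [iInf_lt_iff] at hlt
    obtain ⟨z, hz, hxz⟩ := hlt
    rwa [SimpleGraph.edist_eq_zero_iff.1 (Order.lt_one_iff.1 hxz)]
  · exact le_antisymm (iInf₂_le_of_le x hx (by simp)) (by simp)

lemma le_add_one_of_adj_of_mem_distanceCell {x y : V} {i j : ℕ} (hxy : G.Adj x y)
    (hx : x ∈ distanceCell G C i) (hy : y ∈ distanceCell G C j) : j ≤ i + 1 := by
  suffices (j : ℕ∞) ≤ i + 1 by exact_mod_cast this
  rw [← show (⨅ z ∈ C, G.edist x z) = (i : ℕ∞) from hx,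
    ← show (⨅ z ∈ C, G.edist y z) = (j : ℕ∞) from hy]
  simp only [ENat.iInf_add]
  refine le_iInf₂ fun z hz => iInf₂_le_of_le z hz ?_
  calc G.edist y z ≤ G.edist y x + G.edist x z := SimpleGraph.edist_triangle
    _ = G.edist x z + 1 := by rw [SimpleGraph.edist_eq_one_iff_adj.2 hxy.symm, add_comm]

lemma le_length_of_le_add_one_of_adj {f : V → ℕ} (hstep : ∀ x y, G.Adj x y → f x ≤ f y + 1)
    {x z : V} (hz : f z = 0) (p : G.Walk x z) : f x ≤ p.length := by
  induction p with
  | nil => simp [hz]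
  | @cons u v _ hadj p ih =>
    rw [SimpleGraph.Walk.length_cons]
    exact (hstep u v hadj).trans (Nat.add_le_add_right (ih hz) 1)

lemma exists_edist_le_of_descent {f : V → ℕ}
    (hdesc : ∀ x, f x ≠ 0 → ∃ y, G.Adj x y ∧ f y + 1 = f x) (x : V) :
    ∃ z, f z = 0 ∧ G.edist x z ≤ f x := by
  induction hn : f x generalizing x with
  | zero => exact ⟨x, hn, by simp⟩
  | succ n ih =>
    obtain ⟨y, hxy, hy⟩ := hdesc x (by lia)
    obtain ⟨z, hz, hyz⟩ := ih y (by lia)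
    refine ⟨z, hz, ?_⟩
    calc G.edist x z ≤ G.edist x y + G.edist y z := SimpleGraph.edist_triangle
      _ ≤ 1 + n := add_le_add (SimpleGraph.edist_eq_one_iff_adj.2 hxy).le hyz
      _ = (n + 1 : ℕ) := by rw [Nat.cast_succ, add_comm]

lemma distanceCell_zeroSet {f : V → ℕ} (hstep : ∀ x y, G.Adj x y → f x ≤ f y + 1)
    (hdesc : ∀ x, f x ≠ 0 → ∃ y, G.Adj x y ∧ f y + 1 = f x) (i : ℕ) :
    distanceCell G {z | f z = 0} i = {x | f x = i} := by
  ext x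
  suffices (⨅ z ∈ {z | f z = 0}, G.edist x z) = (f x : ℕ∞) by
    change (⨅ z ∈ {z | f z = 0}, G.edist x z) = (i : ℕ∞) ↔ f x = i
    rw [this, Nat.cast_inj]
  obtain ⟨z, hz, hxz⟩ := exists_edist_le_of_descent hdesc x
  refine le_antisymm (iInf₂_le_of_le z hz hxz) (le_iInf₂ fun w hw => le_iInf fun p => ?_)
  exact_mod_cast le_length_of_le_add_one_of_adj hstep hw p

end DistancePartition

section BinaryWords

variable {n : ℕ}

/-- The vertices of `H(n,2)`. -/
abbrev Word (n : ℕ) : Type := Fin n → Fin 2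

/-- The neighbor of the word `x` in direction `i`: the word `x` with its `i`-th symbol changed. -/
def flipAt (x : Word n) (i : Fin n) : Word n := x + Pi.single i 1

lemma fin_two_add_one_ne (a : Fin 2) : a + 1 ≠ a := by decide +revert

lemma fin_two_eq_add_one {a b : Fin 2} (h : a ≠ b) : a = b + 1 := by decide +revert

lemma flipAt_apply_self (x : Word n) (i : Fin n) : flipAt x i i = x i + 1 := by simp [flipAt]

lemma flipAt_apply_of_ne (x : Word n) {i j : Fin n} (h : j ≠ i) : flipAt x i j = x j := by
  simp [flipAt, h]

lemma word_add_self (x : Word n) : x + x = 0 :=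
  funext fun i => (by decide : ∀ a : Fin 2, a + a = 0) (x i)

lemma flipAt_flipAt (x : Word n) (i : Fin n) : flipAt (flipAt x i) i = x := by
  simp only [flipAt, add_assoc, word_add_self, add_zero]

lemma flipAt_comm (x : Word n) (i j : Fin n) : flipAt (flipAt x i) j = flipAt (flipAt x j) i := by
  simp only [flipAt, add_assoc, add_comm (Pi.single i (1 : Fin 2) : Word n)]

lemma flipAt_injective (x : Word n) : Function.Injective (flipAt x) := by
  intro i j h
  by_contra hij
  have hi := congrFun h i
  rw [flipAt_apply_self, flipAt_apply_of_ne x hij] at hi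
  exact fin_two_add_one_ne _ hi

lemma hammingGraph_adj_iff {x y : Word n} :
    (hammingGraph n 2).Adj x y ↔ ∃ i, flipAt x i = y := by
  change hammingDist x y = 1 ↔ _
  rw [hammingDist, card_eq_one]
  refine exists_congr fun i => ⟨fun h => funext fun j => ?_, ?_⟩
  · have hj : x j ≠ y j ↔ j = i := by simpa using congrArg (j ∈ ·) h
    obtain rfl | hji := eq_or_ne j i
    · rw [flipAt_apply_self]
      exact (fin_two_eq_add_one (hj.2 rfl).symm).symm
    · rw [flipAt_apply_of_ne x hji]
      exact not_not.1 (mt hj.1 hji)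
  · rintro rfl
    ext j
    obtain rfl | hji := eq_or_ne j i
    · simp [flipAt_apply_self, (fin_two_add_one_ne _).symm]
    · simp [flipAt_apply_of_ne x hji, hji]

lemma hammingDist_flipAt (x : Word n) (i : Fin n) : hammingDist x (flipAt x i) = 1 :=
  hammingGraph_adj_iff.2 ⟨i, rfl⟩

lemma encard_neighborSet_inter (x : Word n) (P : Set (Word n)) [DecidablePred (· ∈ P)] :
    ((hammingGraph n 2).neighborSet x ∩ P).encard = (#{i | flipAt x i ∈ P} : ℕ) := by
  have himage : (hammingGraph n 2).neighborSet x ∩ P = flipAt x '' {i | flipAt x i ∈ P} := by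
    ext y
    rw [Set.mem_inter_iff, SimpleGraph.mem_neighborSet, hammingGraph_adj_iff]
    constructor
    · rintro ⟨⟨i, rfl⟩, hP⟩
      exact ⟨i, hP, rfl⟩
    · rintro ⟨i, hi, rfl⟩
      exact ⟨⟨i, rfl⟩, hi⟩
  rw [himage, (flipAt_injective x).encard_image, ← Set.encard_coe_eq_coe_finsetCard]
  simp

end BinaryWords

/-- The fibers of `c` form an equitable partition of `H(n,2)` with quotient matrix `S`; unlike in
`IsEquitablePartition`, some fibers may be empty. -/
def IsEquitable {n m : ℕ} (S : Matrix (Fin m) (Fin m) ℕ) (c : Word n → Fin m) : Prop :=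
  ∀ x j, #{i | c (flipAt x i) = j} = S (c x) j

namespace IsEquitable

variable {n m : ℕ} {S : Matrix (Fin m) (Fin m) ℕ} {c : Word n → Fin m}

lemma ne_zero (h : IsEquitable S c) (x : Word n) (i : Fin n) : S (c x) (c (flipAt x i)) ≠ 0 := by
  rw [← h, card_ne_zero]
  exact ⟨i, by simp⟩

lemma exists_flipAt (h : IsEquitable S c) {x : Word n} {j : Fin m} (hj : S (c x) j ≠ 0) :
    ∃ i, c (flipAt x i) = j := by
  rw [← h x j, card_ne_zero] at hj
  obtain ⟨i, hi⟩ := hj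
  exact ⟨i, by simpa using hi⟩

lemma sum_row (h : IsEquitable S c) (x : Word n) : ∑ j, S (c x) j = n := by
  simp only [← h x]
  rw [← card_eq_sum_card_fiberwise (fun i _ => mem_univ (c (flipAt x i))), card_univ,
    Fintype.card_fin]

/-- A vertex of each cell has a neighbor in the previous cell, and no neighbor in an earlier one, so
the index of the cell is the distance to the first cell. -/
lemma isCRCode {ρ : ℕ} {S : Matrix (Fin (ρ + 1)) (Fin (ρ + 1)) ℕ} {c : Word n → Fin (ρ + 1)}
    (h : IsEquitable S c) (hc : Function.Surjective c)
    (hfar : ∀ i j : Fin (ρ + 1), (i : ℕ) + 1 < j → S j i = 0)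
    (hsub : ∀ i : Fin ρ, S i.succ i.castSucc ≠ 0) :
    IsCRCode (hammingGraph n 2) (fun i : Fin ρ => S i.castSucc i.succ)
      (fun i : Fin ρ => S i.succ i.castSucc) {x | c x = 0} := by
  have hstep (x y : Word n) (hxy : (hammingGraph n 2).Adj x y) : (c x : ℕ) ≤ c y + 1 := by
    obtain ⟨i, rfl⟩ := hammingGraph_adj_iff.1 hxy
    exact not_lt.1 fun hlt => h.ne_zero x i (hfar _ _ hlt)
  have hdesc (x : Word n) (hx : (c x : ℕ) ≠ 0) :
      ∃ y, (hammingGraph n 2).Adj x y ∧ (c y : ℕ) + 1 = c x := by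
    obtain ⟨i, hi⟩ := Fin.exists_succ_eq.2 (Fin.val_ne_zero_iff.1 hx)
    obtain ⟨k, hk⟩ := h.exists_flipAt (x := x) (hi ▸ hsub i)
    exact ⟨_, hammingGraph_adj_iff.2 ⟨k, rfl⟩, by simp [hk, ← hi]⟩
  have hcell (i : Fin (ρ + 1)) :
      distanceCell (hammingGraph n 2) {x | c x = 0} i = {x | c x = i} := by
    simpa only [Fin.val_eq_zero_iff, Fin.val_inj] using distanceCell_zeroSet hstep hdesc (i : ℕ)
  refine ⟨hc 0, S, ⟨fun i => ?_, fun i j hij => ?_, ?_, fun i j x hx => ?_⟩, fun i => ⟨rfl, rfl⟩⟩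
  · rw [hcell]
    exact hc i
  · simp only [hcell]
    exact Set.disjoint_left.2 fun x hx hx' => hij (hx.symm.trans hx')
  · ext x
    simp [hcell]
  · rw [hcell] at hx ⊢
    rw [encard_neighborSet_inter, ← show c x = i from hx, ← h x j]
    rfl

end IsEquitable

lemma IsEquitablePartition.exists_isEquitable {n m : ℕ} {P : Fin m → Set (Word n)}
    {S : Matrix (Fin m) (Fin m) ℕ} (hP : IsEquitablePartition (hammingGraph n 2) P S) :
    ∃ c : Word n → Fin m, IsEquitable S c ∧ ∀ i, P i = {x | c x = i} := by
  classical
  have hcover (x : Word n) : ∃ i, x ∈ P i := by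
    simpa using hP.cover.ge (Set.mem_univ x)
  choose c hc using hcover
  have hfiber (i : Fin m) : P i = {x | c x = i} := by
    ext x
    refine ⟨fun hx => ?_, fun hx => hx ▸ hc x⟩
    by_contra hne
    exact Set.disjoint_left.1 (hP.disjoint hne) (hc x) hx
  refine ⟨c, fun x j => ?_, hfiber⟩
  have hcard := hP.card_neighbors (c x) j x (hc x)
  rw [encard_neighborSet_inter] at hcard
  simp only [hfiber, Set.mem_ofPred_eq] at hcard
  exact_mod_cast hcard

lemma IsCRCode.exists_isEquitable {n ρ : ℕ} {b c : Fin ρ → ℕ} {D : Set (Word n)}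
    (hD : IsCRCode (hammingGraph n 2) b c D) :
    ∃ (S : Matrix (Fin (ρ + 1)) (Fin (ρ + 1)) ℕ) (cell : Word n → Fin (ρ + 1)),
      IsEquitable S cell ∧ Function.Surjective cell ∧ D = {x | cell x = 0} ∧
      (∀ i j : Fin (ρ + 1), (i : ℕ) + 1 < j ∨ (j : ℕ) + 1 < i → S i j = 0) ∧
      ∀ i : Fin ρ, S i.castSucc i.succ = b i ∧ S i.succ i.castSucc = c i := by
  obtain ⟨-, S, hP, hS⟩ := hD
  obtain ⟨cell, hcell, hfiber⟩ := hP.exists_isEquitable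
  have hsurj (i : Fin (ρ + 1)) : ∃ x, cell x = i := by
    obtain ⟨x, hx⟩ := hP.nonempty i
    exact ⟨x, (hfiber i).le hx⟩
  refine ⟨S, cell, hcell, hsurj, by rw [← hfiber 0]; exact (distanceCell_zero _ D).symm, ?_, hS⟩
  intro i j hij
  obtain ⟨x, rfl⟩ := hsurj i
  by_contra hne
  obtain ⟨k, rfl⟩ := hcell.exists_flipAt hne
  have hmem (y : Word n) : y ∈ distanceCell (hammingGraph n 2) D (cell y) :=
    (hfiber (cell y)).ge rfl
  have hadj : (hammingGraph n 2).Adj x (flipAt x k) := hammingGraph_adj_iff.2 ⟨k, rfl⟩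
  have hle := le_add_one_of_adj_of_mem_distanceCell hadj (hmem x) (hmem _)
  have hge := le_add_one_of_adj_of_mem_distanceCell hadj.symm (hmem _) (hmem x)
  lia

/-- The quotient matrix of an equitable partition of `H(13,2)` with intersection array
`{13, 6, 1; 1, 6, 9}`; the diagonal makes the row sums equal to `13`. -/
def quotientMatrix : Matrix (Fin 4) (Fin 4) ℕ :=
  ![![0, 13, 0, 0], ![1, 6, 6, 0], ![0, 6, 6, 1], ![0, 0, 9, 4]]

lemma IsCRCode.exists_isEquitable_quotientMatrix {D : Set (Word 13)}
    (hD : IsCRCode (hammingGraph 13 2) ![13, 6, 1] ![1, 6, 9] D) :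
    ∃ cell : Word 13 → Fin 4, IsEquitable quotientMatrix cell ∧ D = {x | cell x = 0} := by
  obtain ⟨S, cell, hcell, hsurj, hzero, hfar, hS⟩ :
      ∃ (S : Matrix (Fin 4) (Fin 4) ℕ) (cell : Word 13 → Fin 4), _ := hD.exists_isEquitable
  suffices S = quotientMatrix from ⟨cell, this ▸ hcell, hzero⟩
  have hrow (i : Fin 4) : S i 0 + S i 1 + S i 2 + S i 3 = 13 := by
    obtain ⟨x, rfl⟩ := hsurj i
    rw [← hcell.sum_row x, Fin.sum_univ_four]
  have hS0 : S 0 1 = 13 ∧ S 1 0 = 1 := hS 0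
  have hS1 : S 1 2 = 6 ∧ S 2 1 = 6 := hS 1
  have hS2 : S 2 3 = 1 ∧ S 3 2 = 9 := hS 2
  have h02 := hfar 0 2 (by decide)
  have h03 := hfar 0 3 (by decide)
  have h13 := hfar 1 3 (by decide)
  have h20 := hfar 2 0 (by decide)
  have h30 := hfar 3 0 (by decide)
  have h31 := hfar 3 1 (by decide)
  have hrow0 := hrow 0
  have hrow1 := hrow 1
  have hrow2 := hrow 2
  have hrow3 := hrow 3
  ext i j
  fin_cases i <;> fin_cases j <;> simp [quotientMatrix] <;> lia

section DoubleCounting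

variable {n : ℕ}

lemma sum_mul_comp_add (F G : Word n → ℕ) (u : Word n) :
    ∑ x, F x * G (x + u) = ∑ x, G x * F (x + u) := by
  refine Fintype.sum_equiv (Equiv.addRight u) _ _ fun x => ?_
  rw [Equiv.coe_addRight, add_assoc, word_add_self, add_zero, mul_comm]

lemma sum_mul_sum_flipAt (F G : Word n → ℕ) :
    ∑ x, F x * ∑ i, G (flipAt x i) = ∑ x, G x * ∑ i, F (flipAt x i) := by
  simp only [mul_sum]
  rw [sum_comm, sum_comm (s := univ) (t := univ) (f := fun x i => G x * F (flipAt x i))]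
  exact sum_congr rfl fun i _ => sum_mul_comp_add F G (Pi.single i 1)

lemma sum_mul_sum_sum_flipAt (F G : Word n → ℕ) (i : Fin n) :
    ∑ x, F x * ∑ j, ∑ k, G (flipAt (flipAt (flipAt x i) j) k) =
      ∑ x, G x * ∑ j, ∑ k, F (flipAt (flipAt (flipAt x i) j) k) := by
  have hcomm (F G : Word n → ℕ) : ∑ x, F x * ∑ j, ∑ k, G (flipAt (flipAt (flipAt x i) j) k) =
      ∑ j, ∑ k, ∑ x, F x * G (x + (Pi.single i 1 + Pi.single j 1 + Pi.single k 1)) := by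
    simp only [mul_sum, flipAt, add_assoc]
    rw [sum_comm]
    exact sum_congr rfl fun j _ => sum_comm
  rw [hcomm, hcomm]
  exact sum_congr rfl fun j _ => sum_congr rfl fun k _ => sum_mul_comp_add F G _

lemma sum_card_flipAt (P Q : Word n → Prop) [DecidablePred P] [DecidablePred Q] :
    ∑ x with P x, #{i | Q (flipAt x i)} = ∑ x with Q x, #{i | P (flipAt x i)} := by
  have hsum := sum_mul_sum_flipAt (fun x => if P x then 1 else 0) (fun x => if Q x then 1 else 0)
  simpa only [ite_mul, one_mul, zero_mul, ← sum_filter, ← card_eq_sum_ones] using hsum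

lemma card_mul_eq_card_mul {P Q : Word n → Prop} [DecidablePred P] [DecidablePred Q] {a b : ℕ}
    (hP : ∀ x, P x → #{i | Q (flipAt x i)} = a) (hQ : ∀ x, Q x → #{i | P (flipAt x i)} = b) :
    #{x | P x} * a = #{x | Q x} * b := by
  have hsum := sum_card_flipAt P Q
  rwa [sum_const_nat (by simpa using hP), sum_const_nat (by simpa using hQ)] at hsum

lemma sum_card_fiber {m : ℕ} (c : Word n → Fin m) : ∑ j, #{x | c x = j} = 2 ^ n := by
  rw [← card_eq_sum_card_fiberwise (fun x _ => mem_univ (c x))]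
  simp

end DoubleCounting

namespace IsEquitable

lemma sum_comp_flipAt {n m : ℕ} {S : Matrix (Fin m) (Fin m) ℕ} {c : Word n → Fin m}
    (h : IsEquitable S c) (φ : Fin m → ℕ) (x : Word n) :
    ∑ i, φ (c (flipAt x i)) = ∑ k, S (c x) k * φ k := by
  rw [← sum_fiberwise univ (fun i => c (flipAt x i))]
  refine sum_congr rfl fun k _ => ?_
  rw [← h x k]
  exact sum_const_nat fun i hi => by rw [(mem_filter.1 hi).2]

variable {c : Word 13 → Fin 4}

lemma card_cells (h : IsEquitable quotientMatrix c) : #{x | c x = 0} = 288 ∧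
    #{x | c x = 1} = 3744 ∧ #{x | c x = 2} = 3744 ∧ #{x | c x = 3} = 416 := by
  have hmul (j k : Fin 4) :
      #{x | c x = j} * quotientMatrix j k = #{x | c x = k} * quotientMatrix k j :=
    card_mul_eq_card_mul (fun x hx => hx ▸ h x k) fun x hx => hx ▸ h x j
  have h01 : _ * 13 = _ * 1 := hmul 0 1
  have h12 : _ * 6 = _ * 6 := hmul 1 2
  have h23 : _ * 1 = _ * 9 := hmul 2 3
  have htotal := sum_card_fiber c
  rw [Fin.sum_univ_four] at htotal
  lia

lemma isCRCode_zero (h : IsEquitable quotientMatrix c) :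
    IsCRCode (hammingGraph 13 2) ![13, 6, 1] ![1, 6, 9] {x | c x = 0} := by
  have hsurj (j : Fin 4) : ∃ x, c x = j := by
    suffices ({x | c x = j} : Finset (Word 13)).Nonempty by simpa [Finset.Nonempty] using this
    rw [← card_pos]
    obtain ⟨h0, h1, h2, h3⟩ := h.card_cells
    fin_cases j <;> lia
  have hup : (fun i : Fin 3 => quotientMatrix i.castSucc i.succ) = ![13, 6, 1] := by decide
  have hdown : (fun i : Fin 3 => quotientMatrix i.succ i.castSucc) = ![1, 6, 9] := by decide
  have hcode := h.isCRCode (ρ := 3) hsurj (by decide) (by decide)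
  rwa [hup, hdown] at hcode

lemma eq_one_of_eq_zero (h : IsEquitable quotientMatrix c) {x : Word 13} (hx : c x = 0)
    (i : Fin 13) : c (flipAt x i) = 1 := by
  have hne := h.ne_zero x i
  rw [hx] at hne
  generalize c (flipAt x i) = j at *
  decide +revert

lemma eq_two_or_eq_three (h : IsEquitable quotientMatrix c) {x : Word 13} (hx : c x = 3)
    (i : Fin 13) : c (flipAt x i) = 2 ∨ c (flipAt x i) = 3 := by
  have hne := h.ne_zero x i
  rw [hx] at hne
  generalize c (flipAt x i) = j at *
  decide +revert

end IsEquitable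

section Subcubes

variable {n : ℕ}

/-- The sign of a binary symbol, `0 ↦ 1` and `1 ↦ -1`; over `ZMod 3` the signs are exactly the
nonzero elements. -/
def sgn (a : Fin 2) : ZMod 3 := if a = 0 then 1 else -1

lemma sgn_ne_zero (a : Fin 2) : sgn a ≠ 0 := by decide +revert

lemma sgn_mul_self (a : Fin 2) : sgn a * sgn a = 1 := by decide +revert

lemma sgn_add_one (a : Fin 2) : sgn (a + 1) = -sgn a := by decide +revert

lemma sgn_injective : Function.Injective sgn := by decide

/-- The subcube of `H(n,2)` encoded by the ternary word `t`: the symbols at the support of `t` are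
prescribed by the signs of `t`, the others are free. -/
@[irreducible]
def subcube (t : Fin n → ZMod 3) : Finset (Word n) := {x | ∀ i, t i ≠ 0 → sgn (x i) = t i}

/-- The distance from the word `x` to the subcube of `t`. -/
def cubeDist (t : Fin n → ZMod 3) (x : Word n) : ℕ := #{i | t i ≠ 0 ∧ sgn (x i) ≠ t i}

lemma mem_subcube {t : Fin n → ZMod 3} {x : Word n} :
    x ∈ subcube t ↔ ∀ i, t i ≠ 0 → sgn (x i) = t i := by simp [subcube]

lemma cubeDist_eq_zero {t : Fin n → ZMod 3} {x : Word n} : cubeDist t x = 0 ↔ x ∈ subcube t := by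
  rw [cubeDist, card_eq_zero, filter_eq_empty_iff, mem_subcube]
  simp

lemma card_zeros_add_hammingNorm (t : Fin n → ZMod 3) : #{i | t i = 0} + hammingNorm t = n := by
  simpa [hammingNorm] using card_filter_add_card_filter_not (s := univ) (fun i => t i = 0)

lemma card_subcube (t : Fin n → ZMod 3) : #(subcube t) = 2 ^ #{i | t i = 0} := by
  have hpi : subcube t = Fintype.piFinset fun i => {a | t i ≠ 0 → sgn a = t i} := by
    ext x
    simp [mem_subcube]
  have hcoord (s : ZMod 3) : #{a | s ≠ 0 → sgn a = s} = if s = 0 then 2 else 1 := by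
    decide +revert
  simp [hpi, hcoord, prod_ite]

lemma subcube_nonempty (t : Fin n → ZMod 3) : (subcube t).Nonempty := by
  rw [← card_pos, card_subcube]
  positivity

lemma cubeDist_flipAt_add (t : Fin n → ZMod 3) (x : Word n) (i : Fin n) :
    cubeDist t (flipAt x i) + (if t i ≠ 0 ∧ sgn (x i) ≠ t i then 1 else 0) =
      cubeDist t x + (if t i ≠ 0 ∧ sgn (x i) = t i then 1 else 0) := by
  have hsplit (y : Word n) : cubeDist t y = (if t i ≠ 0 ∧ sgn (y i) ≠ t i then 1 else 0) +
      ∑ j ∈ univ.erase i, if t j ≠ 0 ∧ sgn (y j) ≠ t j then 1 else 0 := by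
    rw [cubeDist, card_filter]
    exact (add_sum_erase univ (fun j => if t j ≠ 0 ∧ sgn (y j) ≠ t j then 1 else 0)
      (mem_univ i)).symm
  have hrest : ∑ j ∈ univ.erase i, (if t j ≠ 0 ∧ sgn (flipAt x i j) ≠ t j then 1 else 0) =
      ∑ j ∈ univ.erase i, if t j ≠ 0 ∧ sgn (x j) ≠ t j then 1 else 0 :=
    sum_congr rfl fun j hj => by rw [flipAt_apply_of_ne x (ne_of_mem_erase hj)]
  have hswap (s : ZMod 3) (a : Fin 2) : (if s ≠ 0 ∧ sgn (a + 1) ≠ s then 1 else 0) =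
      if s ≠ 0 ∧ sgn a = s then 1 else 0 := by decide +revert
  rw [hsplit (flipAt x i), hsplit x, hrest, flipAt_apply_self, hswap]
  ring

lemma cubeDist_flipAt_of_eq_zero {t : Fin n → ZMod 3} {i : Fin n} (hi : t i = 0) (x : Word n) :
    cubeDist t (flipAt x i) = cubeDist t x := by
  simpa [hi] using cubeDist_flipAt_add t x i

lemma cubeDist_flipAt_of_mem {t : Fin n → ZMod 3} {x : Word n} (hx : x ∈ subcube t) {i : Fin n}
    (hi : t i ≠ 0) : cubeDist t (flipAt x i) = 1 := by
  simpa [hi, mem_subcube.1 hx i hi, cubeDist_eq_zero.2 hx] using cubeDist_flipAt_add t x i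

lemma cubeDist_flipAt_le (t : Fin n → ZMod 3) (x : Word n) (i : Fin n) :
    cubeDist t (flipAt x i) ≤ cubeDist t x + 1 := by
  have hflip := cubeDist_flipAt_add t x i
  split_ifs at hflip <;> lia

lemma flipAt_mem_subcube_iff {t : Fin n → ZMod 3} {x : Word n} (hx : x ∈ subcube t) {i : Fin n} :
    flipAt x i ∈ subcube t ↔ t i = 0 := by
  rw [← cubeDist_eq_zero]
  by_cases hi : t i = 0
  · simp [hi, cubeDist_flipAt_of_eq_zero hi, cubeDist_eq_zero.2 hx]
  · simp [hi, cubeDist_flipAt_of_mem hx hi]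

lemma eq_of_flipAt_mem_subcube {t : Fin n → ZMod 3} {x : Word n} (hx : x ∉ subcube t) {i j : Fin n}
    (hi : flipAt x i ∈ subcube t) (hj : flipAt x j ∈ subcube t) : i = j := by
  rw [mem_subcube] at hx hi hj
  push Not at hx
  obtain ⟨k, hk, hne⟩ := hx
  have heq (q : Fin n) (hq : ∀ m, t m ≠ 0 → sgn (flipAt x q m) = t m) : k = q := by
    by_contra hkq
    exact hne (by rw [← hq k hk, flipAt_apply_of_ne x hkq])
  exact (heq i hi).symm.trans (heq j hj)

lemma cubeDist_add_card_agree (t : Fin n → ZMod 3) (x : Word n) :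
    cubeDist t x + #{i | t i ≠ 0 ∧ sgn (x i) = t i} = hammingNorm t := by
  have hsplit := card_filter_add_card_filter_not (s := ({i | t i ≠ 0} : Finset (Fin n)))
    (fun i => sgn (x i) = t i)
  rw [filter_filter, filter_filter] at hsplit
  rw [cubeDist, hammingNorm, ← hsplit, add_comm]

lemma cubeDist_le_hammingNorm (t : Fin n → ZMod 3) (x : Word n) : cubeDist t x ≤ hammingNorm t := by
  rw [← cubeDist_add_card_agree t x]
  exact Nat.le_add_right _ _

lemma cubeDist_of_mem_neg {t : Fin n → ZMod 3} {x : Word n} (hx : x ∈ subcube (-t)) :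
    cubeDist t x = hammingNorm t := by
  have hagree : ({i | t i ≠ 0 ∧ sgn (x i) = t i} : Finset (Fin n)) = ∅ := by
    refine filter_eq_empty_iff.2 fun i _ hi => ?_
    have hneg := mem_subcube.1 hx i (by simpa using hi.1)
    rw [hi.2, Pi.neg_apply, eq_comm] at hneg
    exact hi.1 ((by decide : ∀ a : ZMod 3, -a = a → a = 0) _ hneg)
  rw [← cubeDist_add_card_agree t x, hagree, card_empty, add_zero]

/-- For signs `s, e` over `ZMod 3` the product `s * e` is `1` if they agree and `1 + 1` if not. -/
lemma sum_mul_sgn (t : Fin n → ZMod 3) (x : Word n) :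
    ∑ i, t i * sgn (x i) = (hammingNorm t : ZMod 3) + (cubeDist t x : ZMod 3) := by
  have hterm (s : ZMod 3) (a : Fin 2) : s * sgn a = ((if s ≠ 0 then 1 else 0 : ℕ) : ZMod 3) +
      ((if s ≠ 0 ∧ sgn a ≠ s then 1 else 0 : ℕ) : ZMod 3) := by decide +revert
  rw [cubeDist, hammingNorm, card_filter, card_filter, Nat.cast_sum, Nat.cast_sum,
    ← sum_add_distrib]
  exact sum_congr rfl fun i _ => hterm _ _

lemma sum_mul_sgn_eq_zero_iff {t : Fin n → ZMod 3} (ht : 3 ∣ hammingNorm t) (x : Word n) :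
    ∑ i, t i * sgn (x i) = 0 ↔ 3 ∣ cubeDist t x := by
  rw [sum_mul_sgn, (ZMod.natCast_eq_zero_iff _ 3).2 ht, zero_add, ZMod.natCast_eq_zero_iff]

end Subcubes

section TernaryWords

variable {n : ℕ}

/-- The number of positions where both `t` and `s` are nonzero. -/
def overlap (t s : Fin n → ZMod 3) : ℕ := #{i | t i ≠ 0 ∧ s i ≠ 0}

/-- The number of positions where `t` and `s` are nonzero and different. This is the distance
between the subcubes of `t` and `s`. -/
def conflict (t s : Fin n → ZMod 3) : ℕ := #{i | t i ≠ 0 ∧ s i ≠ 0 ∧ t i ≠ s i}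

lemma hammingNorm_neg (t : Fin n → ZMod 3) : hammingNorm (-t) = hammingNorm t := by
  simp [hammingNorm]

lemma conflict_add_conflict_neg (t s : Fin n → ZMod 3) :
    conflict t s + conflict t (-s) = overlap t s := by
  have hterm (a b : ZMod 3) : (if a ≠ 0 ∧ b ≠ 0 ∧ a ≠ b then 1 else 0) +
      (if a ≠ 0 ∧ -b ≠ 0 ∧ a ≠ -b then 1 else 0) = if a ≠ 0 ∧ b ≠ 0 then 1 else 0 := by
    decide +revert
  simp only [conflict, overlap, card_filter, ← sum_add_distrib]
  exact sum_congr rfl fun i _ => hterm _ _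

lemma hammingNorm_add (t s : Fin n → ZMod 3) :
    hammingNorm (t + s) + overlap t s + conflict t s = hammingNorm t + hammingNorm s := by
  have hterm (a b : ZMod 3) : (if a + b ≠ 0 then 1 else 0) + (if a ≠ 0 ∧ b ≠ 0 then 1 else 0) +
      (if a ≠ 0 ∧ b ≠ 0 ∧ a ≠ b then 1 else 0) = (if a ≠ 0 then 1 else 0) +
        if b ≠ 0 then 1 else 0 := by decide +revert
  simp only [conflict, overlap, hammingNorm, card_filter, ← sum_add_distrib]
  exact sum_congr rfl fun i _ => hterm _ _

lemma card_common_zeros (t s : Fin n → ZMod 3) :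
    #{i | t i = 0 ∧ s i = 0} + hammingNorm t + hammingNorm s = n + overlap t s := by
  have hterm (a b : ZMod 3) : (if a = 0 ∧ b = 0 then 1 else 0) + (if a ≠ 0 then 1 else 0) +
      (if b ≠ 0 then 1 else 0) = 1 + if a ≠ 0 ∧ b ≠ 0 then 1 else 0 := by decide +revert
  have hsum := Fintype.sum_congr _ _ fun i => hterm (t i) (s i)
  simp only [sum_add_distrib, ← card_filter] at hsum
  simpa [overlap, hammingNorm] using hsum

lemma conflict_le_hammingDist {t s : Fin n → ZMod 3} {x y : Word n} (hx : x ∈ subcube t)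
    (hy : y ∈ subcube s) : conflict t s ≤ hammingDist x y := by
  refine card_le_card fun i hi => ?_
  obtain ⟨ht, hs, hne⟩ := (mem_filter.1 hi).2
  refine mem_filter.2 ⟨mem_univ i, fun hxy => hne ?_⟩
  rw [← mem_subcube.1 hx i ht, ← mem_subcube.1 hy i hs, hxy]

lemma exists_mem_subcube_cubeDist_eq_conflict (t s : Fin n → ZMod 3) :
    ∃ y ∈ subcube s, cubeDist t y = conflict t s := by
  obtain ⟨y, hy⟩ := subcube_nonempty fun i => if s i ≠ 0 then s i else t i
  have hys (i : Fin n) (hi : s i ≠ 0) : sgn (y i) = s i := by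
    simpa [hi] using mem_subcube.1 hy i
  refine ⟨y, mem_subcube.2 hys, ?_⟩
  rw [cubeDist, conflict]
  refine congrArg card (filter_congr fun i _ => and_congr_right fun ht => ?_)
  by_cases hi : s i = 0
  · have hyt : sgn (y i) = t i := by simpa [hi, ht] using mem_subcube.1 hy i
    simp [hi, hyt]
  · simp [hi, hys i hi, eq_comm]

end TernaryWords

/-- Start from a word of `Z` in the subcube, and let `w` be its neighbor in a free direction. Every
direction out of the subcube leads from `w` to a word at distance `1` from the subcube. A word of
`Z` at distance at most `1` from there would lie in the subcube by divisibility, hence would be `w`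
itself. So `w` can be close to `Z` in the free directions only. -/
lemma three_le_cubeDist_of_dvd {n : ℕ} {Z : Finset (Word n)} {u : Fin n → ZMod 3}
    (hfree : ∃ b, u b = 0) (hZ : ∀ z ∈ Z, ∀ i, flipAt z i ∉ Z)
    (hnear : ∀ z ∈ Z, ∀ b, #{i | u i = 0} <
      #{q | flipAt (flipAt z b) q ∈ Z ∨ ∃ k, flipAt (flipAt (flipAt z b) q) k ∈ Z})
    (hdvd : ∀ z ∈ Z, 3 ∣ cubeDist u z) {z : Word n} (hz : z ∈ Z) : 3 ≤ cubeDist u z := by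
  refine Nat.le_of_dvd (Nat.pos_of_ne_zero fun hzero => ?_) (hdvd z hz)
  obtain ⟨b, hb⟩ := hfree
  set w := flipAt z b
  have hwu : w ∈ subcube u := (flipAt_mem_subcube_iff (cubeDist_eq_zero.1 hzero)).2 hb
  refine (hnear z hz b).not_ge (card_le_card fun q hq => ?_)
  rw [mem_filter] at hq ⊢
  refine ⟨mem_univ q, by_contra fun huq => ?_⟩
  have hv : cubeDist u (flipAt w q) = 1 := cubeDist_flipAt_of_mem hwu huq
  rcases hq.2 with hmem | ⟨k, hmem⟩
  · have := hdvd _ hmem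
    lia
  · have hle := cubeDist_flipAt_le u (flipAt w q) k
    have hmem' : flipAt (flipAt w q) k ∈ subcube u := by
      have := hdvd _ hmem
      rw [← cubeDist_eq_zero]
      lia
    obtain rfl | hkq := eq_or_ne q k
    · rw [flipAt_flipAt] at hmem
      exact hZ z hz b hmem
    · have hsgn := mem_subcube.1 hmem' q huq
      rw [flipAt_apply_of_ne _ hkq, flipAt_apply_self, sgn_add_one,
        mem_subcube.1 hwu q huq] at hsgn
      exact huq ((by decide : ∀ a : ZMod 3, -a = a → a = 0) _ hsgn)

section HalfSystems

/-- `X` contains exactly one vector of each pair `±w` with `w ≠ 0`, and no other vector. -/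
def IsHalfSet {V : Type*} [AddGroup V] (X : Set V) : Prop := ∀ w, w ∈ X ↔ w ≠ 0 ∧ -w ∉ X

/-- The vectors `p i` are distinct and form a half set. Over `ZMod 3` these are the families that
contain one vector on each line through `0`, i.e. one for each point of the projective space. -/
def IsHalfSystem {ι V : Type*} [AddGroup V] (p : ι → V) : Prop :=
  Function.Injective p ∧ IsHalfSet (Set.range p)

variable {ι V V' : Type*} [AddCommGroup V] [AddCommGroup V'] {p : ι → V}

lemma IsHalfSet.ne_zero {X : Set V} (h : IsHalfSet X) {w : V} (hw : w ∈ X) : w ≠ 0 :=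
  ((h w).1 hw).1

lemma IsHalfSet.neg_notMem {X : Set V} (h : IsHalfSet X) {w : V} (hw : w ∈ X) : -w ∉ X :=
  ((h w).1 hw).2

lemma IsHalfSet.neg_mem {X : Set V} (h : IsHalfSet X) {w : V} (h0 : w ≠ 0) (hw : w ∉ X) :
    -w ∈ X :=
  (h (-w)).2 ⟨neg_ne_zero.2 h0, by rwa [neg_neg]⟩

namespace IsHalfSystem

lemma ne_zero (h : IsHalfSystem p) (i : ι) : p i ≠ 0 := h.2.ne_zero ⟨i, rfl⟩

lemma ne_neg (h : IsHalfSystem p) (i j : ι) : p i ≠ -p j :=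
  fun hij => h.2.neg_notMem ⟨j, rfl⟩ ⟨i, hij⟩

lemma map (h : IsHalfSystem p) (e : V ≃+ V') : IsHalfSystem fun i => e (p i) := by
  refine ⟨e.injective.comp h.1, fun w => ?_⟩
  obtain ⟨v, rfl⟩ := e.surjective w
  have hrange (u : V) : e u ∈ Set.range (fun i => e (p i)) ↔ u ∈ Set.range p := by simp
  rw [← map_neg, hrange, hrange, e.map_ne_zero_iff]
  exact h.2 v

lemma injective_elim (hinj : Function.Injective p) (hneg : ∀ i j, p i ≠ -p j) (h0 : ∀ i, p i ≠ 0) :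
    Function.Injective fun o : Option (ι ⊕ ι) => o.elim 0 (Sum.elim p (-p)) := by
  rintro (_ | i | i) (_ | j | j) hij
  · rfl
  · exact absurd hij.symm (h0 j)
  · exact absurd hij.symm (neg_ne_zero.2 (h0 j))
  · exact absurd hij (h0 i)
  · rw [hinj hij]
  · exact absurd hij (hneg i j)
  · exact absurd hij (neg_ne_zero.2 (h0 i))
  · exact absurd hij.symm (hneg j i)
  · rw [hinj (neg_injective hij)]

lemma bijective_elim (h : IsHalfSystem p) :
    Function.Bijective fun o : Option (ι ⊕ ι) => o.elim 0 (Sum.elim p (-p)) := by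
  refine ⟨injective_elim h.1 h.ne_neg h.ne_zero, fun w => ?_⟩
  by_cases h0 : w = 0
  · exact ⟨none, h0.symm⟩
  by_cases hw : w ∈ Set.range p
  · obtain ⟨i, rfl⟩ := hw
    exact ⟨some (.inl i), rfl⟩
  · obtain ⟨i, hi⟩ := h.2.neg_mem h0 hw
    exact ⟨some (.inr i), neg_eq_iff_eq_neg.2 hi⟩

lemma of_card [Finite ι] [Finite V] (hinj : Function.Injective p) (hneg : ∀ i j, p i ≠ -p j)
    (h0 : ∀ i, p i ≠ 0) (hcard : Nat.card V = 2 * Nat.card ι + 1) : IsHalfSystem p := by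
  have hbij := (Nat.bijective_iff_injective_and_card _).2
    ⟨injective_elim hinj hneg h0, by simp [hcard, two_mul, Nat.card_sum]⟩
  refine ⟨hinj, fun w => ⟨?_, fun ⟨hw0, hw⟩ => ?_⟩⟩
  · rintro ⟨i, rfl⟩
    exact ⟨h0 i, fun ⟨j, hj⟩ => hneg j i hj⟩
  · obtain ⟨_ | i | i, hi⟩ := hbij.2 w
    · exact absurd hi.symm hw0
    · exact ⟨i, hi⟩
    · exact absurd ⟨i, neg_eq_iff_eq_neg.1 hi⟩ hw

lemma natCard_eq [Finite ι] (h : IsHalfSystem p) : Nat.card V = 2 * Nat.card ι + 1 := by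
  rw [← Nat.card_eq_of_bijective _ h.bijective_elim]
  simp [two_mul, Nat.card_sum]

lemma finite [Finite ι] (h : IsHalfSystem p) : Finite V := .of_surjective _ h.bijective_elim.2

variable [Module (ZMod 3) V]

lemma restrict (h : IsHalfSystem p) (W : Submodule (ZMod 3) V) :
    IsHalfSystem fun i : {i // p i ∈ W} => (⟨p i, i.2⟩ : W) := by
  refine ⟨fun i j hij => Subtype.ext (h.1 (congrArg Subtype.val hij)), fun w => ?_⟩
  have hrange (w : W) : w ∈ Set.range (fun i : {i // p i ∈ W} => (⟨p i, i.2⟩ : W)) ↔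
      (w : V) ∈ Set.range p :=
    ⟨fun ⟨i, hi⟩ => ⟨i, congrArg Subtype.val hi⟩,
      fun ⟨i, hi⟩ => ⟨⟨i, hi ▸ w.2⟩, Subtype.ext hi⟩⟩
  rw [hrange, hrange, Submodule.coe_neg, ne_eq, ← Submodule.coe_eq_zero]
  exact h.2 w

lemma sgn_smul [Finite ι] (h : IsHalfSystem p) (x : ι → Fin 2) :
    IsHalfSystem fun i => sgn (x i) • p i := by
  have := h.finite
  have hsgn (a : Fin 2) : sgn a = 1 ∨ sgn a = -1 := by decide +revert
  have hx (i j : ι) (hij : sgn (x i) • p i = sgn (x j) • p j ∨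
      sgn (x i) • p i = -(sgn (x j) • p j)) : p i = p j ∨ p i = -p j := by
    rcases hsgn (x i) with hi | hi <;> rcases hsgn (x j) with hj | hj <;>
      simpa [hi, hj, neg_eq_iff_eq_neg, or_comm] using hij
  have hinj (i j : ι) (hij : sgn (x i) • p i = sgn (x j) • p j) : i = j :=
    h.1 ((hx i j (.inl hij)).resolve_right (h.ne_neg i j))
  refine of_card hinj (fun i j hij => ?_) (fun i => ?_) h.natCard_eq
  · obtain rfl := h.1 ((hx i j (.inr hij)).resolve_right (h.ne_neg i j))
    rw [← smul_neg] at hij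
    exact h.ne_neg i i (smul_right_injective V (sgn_ne_zero (x i)) hij)
  · exact smul_ne_zero (sgn_ne_zero (x i)) (h.ne_zero i)

lemma card_dual_eq_zero [Fintype ι] (h : IsHalfSystem p) {a : Module.Dual (ZMod 3) V}
    (ha : a ≠ 0) : 3 * (2 * #{i | a (p i) = 0} + 1) = 2 * Fintype.card ι + 1 := by
  have hker := (h.restrict (LinearMap.ker a)).natCard_eq
  have hquot : Nat.card (V ⧸ LinearMap.ker a) = 3 := by
    rw [Nat.card_congr (a.quotKerEquivOfSurjective (a.surjective ha)).toEquiv, Nat.card_zmod]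
  have hcard := Submodule.card_eq_card_quotient_mul_card (LinearMap.ker a)
  rw [hquot, h.natCard_eq, hker] at hcard
  simpa [Fintype.card_subtype, mul_comm] using hcard.symm

end IsHalfSystem

end HalfSystems

section SimplexCode

variable {V : Type*} [AddCommGroup V] [Module (ZMod 3) V] {p : Fin 13 → V}

/-- The word of the values of a linear form at the points `p i`. If `p` is a half system, these
words form the simplex code. -/
def dualWord (p : Fin 13 → V) (a : Module.Dual (ZMod 3) V) (i : Fin 13) : ZMod 3 := a (p i)

namespace IsHalfSystem

lemma card_dualWord_eq_zero (h : IsHalfSystem p) {a : Module.Dual (ZMod 3) V} (ha : a ≠ 0) :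
    #{i | dualWord p a i = 0} = 4 := by
  have hcard := h.card_dual_eq_zero ha
  rw [Fintype.card_fin] at hcard
  change #{i | a (p i) = 0} = 4
  lia

lemma hammingNorm_dualWord (h : IsHalfSystem p) {a : Module.Dual (ZMod 3) V} (ha : a ≠ 0) :
    hammingNorm (dualWord p a) = 9 := by
  have hcard := card_zeros_add_hammingNorm (dualWord p a)
  rw [h.card_dualWord_eq_zero ha] at hcard
  lia

lemma three_le_conflict_dualWord (h : IsHalfSystem p) {a b : Module.Dual (ZMod 3) V} (ha : a ≠ 0)
    (hb : b ≠ 0) (hab : a ≠ b) : 3 ≤ conflict (dualWord p a) (dualWord p b) := by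
  have hsum : hammingNorm (dualWord p a + dualWord p b) = 0 ∨
      hammingNorm (dualWord p a + dualWord p b) = 9 := by
    obtain hzero | hne := eq_or_ne (a + b) 0
    · left
      rw [show dualWord p a + dualWord p b = dualWord p (a + b) from rfl, hzero]
      exact hammingNorm_zero
    · exact .inr (h.hammingNorm_dualWord hne)
  have hdiff : hammingNorm (dualWord p a + -dualWord p b) = 9 := by
    rw [← sub_eq_add_neg]
    exact h.hammingNorm_dualWord (sub_ne_zero.2 hab)
  have hadd := hammingNorm_add (dualWord p a) (dualWord p b)
  have hadd_neg := hammingNorm_add (dualWord p a) (-dualWord p b)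
  rw [hammingNorm_neg, h.hammingNorm_dualWord ha, h.hammingNorm_dualWord hb] at *
  have hconflict := conflict_add_conflict_neg (dualWord p a) (dualWord p b)
  have hconflict_neg := conflict_add_conflict_neg (dualWord p a) (-dualWord p b)
  rw [neg_neg] at hconflict_neg
  lia

lemma finrank_eq_three (h : IsHalfSystem p) : Module.finrank (ZMod 3) V = 3 := by
  have := h.finite
  have hV : Nat.card V = 27 := by simp [h.natCard_eq]
  have hcard := Module.natCard_eq_pow_finrank (K := ZMod 3) (V := V)
  rw [hV, Nat.card_zmod] at hcard
  exact (Nat.pow_right_injective (by simp : 2 ≤ 3) hcard).symm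

lemma natCard_dual (h : IsHalfSystem p) : Nat.card (Module.Dual (ZMod 3) V) = 27 := by
  have := h.finite
  rw [Module.natCard_eq_pow_finrank (K := ZMod 3), Subspace.dual_finrank_eq, h.finrank_eq_three,
    Nat.card_zmod]
  rfl

end IsHalfSystem

lemma exists_linearEquiv_apply_eq {K W : Type*} [Field K] [AddCommGroup W] [Module K W]
    {v w : W} (hv : v ≠ 0) (hw : w ≠ 0) : ∃ g : W ≃ₗ[K] W, g v = w := by
  let ev := LinearEquiv.toSpanNonzeroSingleton K W v hv
  let ew := LinearEquiv.toSpanNonzeroSingleton K W w hw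
  obtain ⟨g, hg⟩ := Submodule.exists_linearEquiv_restrict_eq (ev.symm ≪≫ₗ ew)
  refine ⟨g, ?_⟩
  have hgv := hg (ev 1)
  rw [LinearEquiv.trans_apply, LinearEquiv.symm_apply_apply] at hgv
  simpa [ev, ew] using hgv.symm

lemma IsHalfSystem.exists_linearEquiv (h : IsHalfSystem p) {s : V} (hs : s ≠ 0) :
    ∃ e : V ≃ₗ[ZMod 3] ZMod 3 × ZMod 3 × ZMod 3, e s = (1, 0) := by
  have := h.finite
  let e := LinearEquiv.ofFinrankEq V (ZMod 3 × ZMod 3 × ZMod 3) (by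
    rw [h.finrank_eq_three, Module.finrank_prod, Module.finrank_prod, Module.finrank_self])
  obtain ⟨g, hg⟩ := exists_linearEquiv_apply_eq (K := ZMod 3) (e.map_ne_zero_iff.2 hs)
    (by decide : ((1, 0) : ZMod 3 × ZMod 3 × ZMod 3) ≠ 0)
  exact ⟨e.trans g, hg⟩

end SimplexCode

section Fibers

variable {W : Type*} [DecidableEq W]

/-- The fiber over `u` of the projection `ZMod 3 × W → W` restricted to `X`. -/
def fiber (X : Finset (ZMod 3 × W)) (u : W) : Finset (ZMod 3) := {l | (l, u) ∈ X}

lemma mem_fiber {X : Finset (ZMod 3 × W)} {u : W} {l : ZMod 3} : l ∈ fiber X u ↔ (l, u) ∈ X := by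
  simp [fiber]

lemma card_filter_add_one_notMem (A : Finset (ZMod 3)) :
    #{l ∈ A | l + 1 ∉ A} = if (#A : ZMod 3) = 0 then 0 else 1 := by decide +revert

lemma sum_eq_sum_fiber [Fintype W] {M : Type*} [AddCommMonoid M] (X : Finset (ZMod 3 × W))
    (F : ZMod 3 × W → M) : ∑ x ∈ X, F x = ∑ u, ∑ l ∈ fiber X u, F (l, u) := by
  simp only [fiber, sum_filter]
  rw [← Fintype.sum_prod_type_right (fun x => if x ∈ X then F x else 0), ← sum_filter,
    filter_univ_mem]

variable [AddCommGroup W] {X : Finset (ZMod 3 × W)}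

lemma card_filter_add_notMem [Fintype W] (X : Finset (ZMod 3 × W)) :
    #{x ∈ X | x + (1, 0) ∉ X} = #{u | (#(fiber X u) : ZMod 3) ≠ 0} := by
  rw [card_filter, sum_eq_sum_fiber, card_filter]
  refine sum_congr rfl fun u _ => ?_
  simp only [Prod.mk_add_mk, add_zero, ← mem_fiber]
  rw [← card_filter, card_filter_add_one_notMem, ite_not]

lemma card_fiber_zero (hX : IsHalfSet (X : Set (ZMod 3 × W))) : #(fiber X 0) = 1 := by
  have hhalf (l : ZMod 3) : l ∈ fiber X 0 ↔ l ≠ 0 ∧ -l ∉ fiber X 0 := by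
    simpa [mem_fiber] using hX (l, 0)
  generalize fiber X 0 = A at hhalf
  decide +revert

lemma card_fiber_add_card_fiber_neg (hX : IsHalfSet (X : Set (ZMod 3 × W))) {u : W} (hu : u ≠ 0) :
    #(fiber X u) + #(fiber X (-u)) = 3 := by
  have hcompl : fiber X (-u) = (fiber X u)ᶜ.map (Equiv.neg _).toEmbedding := by
    ext l
    simpa [mem_fiber, hu] using hX (l, -u)
  rw [hcompl, card_map, card_add_card_compl]
  rfl

end Fibers

section Tetracode

/-- Up to sign, there are four nonzero vectors `u`; the values of `f` there form a word of the
tetracode, whose nonzero words have weight `3`. -/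
lemma card_ne_zero_eq_seven_or_eq_zero {f : ZMod 3 × ZMod 3 → ZMod 3} (h0 : f 0 ≠ 0)
    (hneg : ∀ u, u ≠ 0 → f (-u) = -f u) (hsum : ∑ u, f u • u = 0) :
    #{u | f u ≠ 0} = 7 ∨ ∀ u, u ≠ 0 → f u = 0 := by
  have h10 : f (2, 0) = -f (1, 0) := hneg (1, 0) (by decide)
  have h01 : f (0, 2) = -f (0, 1) := hneg (0, 1) (by decide)
  have h11 : f (2, 2) = -f (1, 1) := hneg (1, 1) (by decide)
  have h12 : f (2, 1) = -f (1, 2) := hneg (1, 2) (by decide)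
  have h00 : f (0, 0) ≠ 0 := h0
  have hsum3 {M : Type} [AddCommMonoid M] (g : ZMod 3 → M) : ∑ a, g a = g 0 + g 1 + g 2 :=
    Fin.sum_univ_three g
  have hall : (∀ u, u ≠ 0 → f u = 0) ↔
      f (1, 0) = 0 ∧ f (0, 1) = 0 ∧ f (1, 1) = 0 ∧ f (1, 2) = 0 := by
    refine ⟨fun h => by simp [h], fun h u hu => ?_⟩
    have hrep (w : ZMod 3 × ZMod 3) (hw : w = (1, 0) ∨ w = (0, 1) ∨ w = (1, 1) ∨ w = (1, 2)) :
        f w = 0 := by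
      obtain rfl | rfl | rfl | rfl := hw <;> simp [h]
    obtain hu' | hu' : (u = (1, 0) ∨ u = (0, 1) ∨ u = (1, 1) ∨ u = (1, 2)) ∨
        -u = (1, 0) ∨ -u = (0, 1) ∨ -u = (1, 1) ∨ -u = (1, 2) := by
      clear * - hu
      decide +revert
    · exact hrep u hu'
    · rw [← neg_neg u, hneg (-u) (neg_ne_zero.2 hu), hrep _ hu', neg_zero]
  rw [hall, card_filter]
  rw [Fintype.sum_prod_type, hsum3] at hsum ⊢
  simp only [hsum3, h10, h01, h11, h12, Prod.smul_mk, Prod.mk_add_mk] at hsum ⊢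
  generalize f (1, 0) = a at *
  generalize f (0, 1) = b at *
  generalize f (1, 1) = c at *
  generalize f (1, 2) = d at *
  generalize f (0, 0) = e at *
  clear * - hsum h00
  decide +revert

lemma exists_dual_ne_neg_one {Y : Set (ZMod 3 × ZMod 3)} (hY : ∀ w ∈ Y, -w ∉ Y) :
    ∃ a : Module.Dual (ZMod 3) (ZMod 3 × ZMod 3), a ≠ 0 ∧ ∀ w ∈ Y, a w ≠ -1 := by
  have hsign (w : ZMod 3 × ZMod 3) : ∃ ε : Fin 2, -(sgn ε • w) ∉ Y := by
    by_cases hw : -w ∈ Y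
    · exact ⟨1, by simpa [sgn] using hY _ hw⟩
    · exact ⟨0, by simpa [sgn] using hw⟩
  obtain ⟨ε₁, h₁⟩ := hsign (1, 0)
  obtain ⟨ε₂, h₂⟩ := hsign (0, 1)
  obtain ⟨ε₃, h₃⟩ := hsign (1, 1)
  obtain ⟨ε₄, h₄⟩ := hsign (1, 2)
  obtain ⟨α, β, hne, hαβ⟩ : ∃ α β : ZMod 3, (α ≠ 0 ∨ β ≠ 0) ∧ ∀ w : ZMod 3 × ZMod 3,
      α * w.1 + β * w.2 = -1 → w = -(sgn ε₁ • (1, 0)) ∨ w = -(sgn ε₂ • (0, 1)) ∨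
        w = -(sgn ε₃ • (1, 1)) ∨ w = -(sgn ε₄ • (1, 2)) := by
    clear * -
    decide +revert
  refine ⟨α • LinearMap.fst _ _ _ + β • LinearMap.snd _ _ _, fun h0 => ?_, fun w hw haw => ?_⟩
  · refine hne.elim (fun hα => hα ?_) fun hβ => hβ ?_
    · simpa using LinearMap.congr_fun h0 (1, 0)
    · simpa using LinearMap.congr_fun h0 (0, 1)
  · obtain rfl | rfl | rfl | rfl := hαβ w haw
    exacts [h₁ hw, h₂ hw, h₃ hw, h₄ hw]

lemma exists_dual_ne_neg_one_of_fiber {X : Finset (ZMod 3 × ZMod 3 × ZMod 3)}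
    (hX : IsHalfSet (X : Set (ZMod 3 × ZMod 3 × ZMod 3)))
    (hfiber : ∀ u, u ≠ 0 → fiber X u = ∅ ∨ fiber X u = univ) :
    ∃ a : Module.Dual (ZMod 3) (ZMod 3 × ZMod 3 × ZMod 3), a ≠ 0 ∧ ∀ x ∈ X, a x ≠ -1 := by
  obtain ⟨a, ha, hne⟩ := exists_dual_ne_neg_one (Y := {u | (0, u) ∈ X}) fun u hu hu' =>
    hX.neg_notMem hu (by simpa using hu')
  refine ⟨a ∘ₗ LinearMap.snd _ _ _, fun h0 => ha ?_, ?_⟩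
  · ext1 <;> ext1 <;> simpa using LinearMap.congr_fun h0 (0, _)
  · rintro ⟨l, u⟩ hx
    obtain rfl | hu := eq_or_ne u 0
    · simp
    · have hl : l ∈ fiber X u := mem_fiber.2 hx
      refine hne u (mem_fiber.1 ?_)
      rw [(hfiber u hu).resolve_left (ne_empty_of_mem hl)]
      exact mem_univ _

lemma card_filter_add_notMem_eq_seven_or_eq_one {X : Finset (ZMod 3 × ZMod 3 × ZMod 3)}
    (hX : IsHalfSet (X : Set (ZMod 3 × ZMod 3 × ZMod 3))) (hsum : ∑ x ∈ X, x = (1, 0)) :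
    #{x ∈ X | x + (1, 0) ∉ X} = 7 ∨ #{x ∈ X | x + (1, 0) ∉ X} = 1 ∧ (1, 0) ∈ X ∧
      ∃ a : Module.Dual (ZMod 3) (ZMod 3 × ZMod 3 × ZMod 3), a ≠ 0 ∧ ∀ x ∈ X, a x ≠ -1 := by
  have hneg (u : ZMod 3 × ZMod 3) (hu : u ≠ 0) :
      (#(fiber X (-u)) : ZMod 3) = -#(fiber X u) := by
    have hcard := congrArg (Nat.cast (R := ZMod 3)) (card_fiber_add_card_fiber_neg hX hu)
    push_cast at hcard
    rw [eq_neg_iff_add_eq_zero, add_comm, hcard]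
    rfl
  have hsnd : ∑ u, (#(fiber X u) : ZMod 3) • u = 0 := by
    have := congrArg Prod.snd hsum
    rw [Prod.snd_sum, sum_eq_sum_fiber] at this
    simpa [Nat.cast_smul_eq_nsmul] using this
  rw [card_filter_add_notMem]
  refine (card_ne_zero_eq_seven_or_eq_zero (by simp [card_fiber_zero hX]) hneg hsnd).imp_right
    fun hzero => ?_
  have hfull (u : ZMod 3 × ZMod 3) (hu : u ≠ 0) : fiber X u = ∅ ∨ fiber X u = univ := by
    have := hzero u hu
    generalize fiber X u = A at this
    clear * - this
    decide +revert
  have hfst : ∑ l ∈ fiber X 0, l = 1 := by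
    have := congrArg Prod.fst hsum
    rw [Prod.fst_sum, sum_eq_sum_fiber] at this
    rw [Fintype.sum_eq_single 0] at this
    · exact this
    · intro u hu
      obtain h | h := hfull u hu <;> rw [h] <;> rfl
  have hone : fiber X 0 = {1} := by
    obtain ⟨l, hl⟩ := card_eq_one.1 (card_fiber_zero hX)
    rwa [hl, sum_singleton, ← singleton_inj, ← hl] at hfst
  refine ⟨?_, mem_fiber.1 (by simp [hone]), exists_dual_ne_neg_one_of_fiber hX hfull⟩
  refine card_eq_one.2 ⟨0, ?_⟩
  ext u
  rw [mem_filter_univ, mem_singleton]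
  exact ⟨not_imp_comm.1 (hzero u), by rintro rfl; simp [hone]⟩

/-- If `s` is the sum, then `7 = 1 + 6` is the case of a word at distance `2` from the ternary
Hamming code, and `1` that of a word at distance `3`. -/
lemma IsHalfSystem.card_forall_ne_add_sum {V : Type*} [AddCommGroup V] [Module (ZMod 3) V]
    [DecidableEq V] {v : Fin 13 → V} (h : IsHalfSystem v) (hs : ∑ k, v k ≠ 0) :
    #{i | ∀ j, v j ≠ v i + ∑ k, v k} = 7 ∨
      #{i | ∀ j, v j ≠ v i + ∑ k, v k} = 1 ∧ (∃ i, v i = ∑ k, v k) ∧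
        ∃ a : Module.Dual (ZMod 3) V, a ≠ 0 ∧ ∀ i, a (v i) ≠ -1 := by
  obtain ⟨e, he⟩ := h.exists_linearEquiv hs
  have hv : IsHalfSystem fun i => e (v i) := h.map e.toAddEquiv
  set X : Finset (ZMod 3 × ZMod 3 × ZMod 3) := univ.map ⟨_, hv.1⟩ with hX
  have hmem (w : V) : e w ∈ X ↔ ∃ i, v i = w := by simp [hX]
  have hcard : #{i | ∀ j, v j ≠ v i + ∑ k, v k} = #{x ∈ X | x + (1, 0) ∉ X} := by
    rw [hX, filter_map, card_map, ← hX, ← he]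
    refine congrArg card (filter_congr fun i _ => ?_)
    change _ ↔ e (v i) + e (∑ k, v k) ∉ X
    rw [← map_add, hmem, not_exists]
  have hhalf : IsHalfSet (X : Set (ZMod 3 × ZMod 3 × ZMod 3)) := by simpa [hX] using hv.2
  have hsum : ∑ x ∈ X, x = (1, 0) := by simpa [hX] using he
  rw [hcard, ← hmem, he]
  refine (card_filter_add_notMem_eq_seven_or_eq_one hhalf hsum).imp_right
    (And.imp_right (And.imp_right fun ⟨a, ha, hne⟩ =>
      ⟨e.dualMap a, e.dualMap.map_ne_zero_iff.2 ha, fun i => hne _ ((hmem _).2 ⟨i, rfl⟩)⟩))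

end Tetracode

section Syndrome

variable {n : ℕ} {V : Type*} [AddCommGroup V] [Module (ZMod 3) V]

lemma neg_eq_add_self (v : V) : -v = v + v := by
  rw [← neg_one_smul (ZMod 3), ← two_smul (ZMod 3)]
  rfl

/-- The syndrome of the binary word `x`, with its symbols `0`, `1` read as `1`, `-1`, for the
ternary code with parity check columns `p i`. -/
def syndrome (p : Fin n → V) (x : Word n) : V := ∑ i, sgn (x i) • p i

lemma syndrome_flipAt (p : Fin n → V) (x : Word n) (i : Fin n) :
    syndrome p (flipAt x i) = syndrome p x + sgn (x i) • p i := by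
  have hterm (j : Fin n) : sgn (flipAt x i j) • p j =
      sgn (x j) • p j + if j = i then sgn (x i) • p i else 0 := by
    obtain rfl | hji := eq_or_ne j i
    · rw [flipAt_apply_self, sgn_add_one, neg_smul, neg_eq_add_self, if_pos rfl]
    · rw [flipAt_apply_of_ne x hji, if_neg hji, add_zero]
  simp only [syndrome, hterm, sum_add_distrib, sum_ite_eq', mem_univ, if_true]

/-- `x` is at distance at most `1` from the words with syndrome `0`. -/
abbrev IsNear (p : Fin n → V) (x : Word n) : Prop :=
  syndrome p x = 0 ∨ ∃ i, syndrome p (flipAt x i) = 0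

end Syndrome

namespace IsHalfSystem

variable {n : ℕ} {V : Type*} [AddCommGroup V] [Module (ZMod 3) V] {p : Fin n → V} {x : Word n}

lemma syndrome_flipAt_ne_zero (h : IsHalfSystem p) (hx : syndrome p x = 0) (i : Fin n) :
    syndrome p (flipAt x i) ≠ 0 := by
  rw [syndrome_flipAt, hx, zero_add]
  exact smul_ne_zero (sgn_ne_zero _) (h.ne_zero i)

lemma isNear_iff (h : IsHalfSystem p) : IsNear p x ↔ ∀ i, sgn (x i) • p i ≠ syndrome p x := by
  have hv := h.sgn_smul x
  obtain hs | hs := eq_or_ne (syndrome p x) 0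
  · exact iff_of_true (.inl hs) fun i => hs ▸ hv.ne_zero i
  · simp only [IsNear, hs, false_or, syndrome_flipAt, ← not_exists]
    refine ⟨fun ⟨i, hi⟩ ⟨j, hj⟩ => hv.ne_neg j i (hj.trans (eq_neg_of_add_eq_zero_left hi)),
      fun hne => ?_⟩
    obtain ⟨i, hi⟩ := hv.2.neg_mem hs hne
    exact ⟨i, by rw [add_eq_zero_iff_neg_eq]; exact hi.symm⟩

lemma isNear_flipAt_iff (h : IsHalfSystem p) (hs : syndrome p x ≠ 0) (q : Fin n) :
    IsNear p (flipAt x q) ↔ (∀ k, sgn (x k) • p k ≠ sgn (x q) • p q + syndrome p x) ∧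
      sgn (x q) • p q ≠ syndrome p x := by
  have hself : sgn (flipAt x q q) • p q = sgn (x q) • p q + syndrome p x ↔
      sgn (x q) • p q = syndrome p x := by
    rw [flipAt_apply_self, sgn_add_one, neg_smul, neg_eq_add_self, add_right_inj]
  rw [h.isNear_iff, syndrome_flipAt, add_comm (syndrome p x)]
  refine ⟨fun hne => ⟨fun k => ?_, fun hq => hne q (hself.2 hq)⟩, fun ⟨hne, hq⟩ k => ?_⟩
  all_goals obtain rfl | hkq := eq_or_ne k q
  · simpa using hs
  · simpa only [flipAt_apply_of_ne x hkq] using hne k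
  · exact fun hk => hq (hself.1 hk)
  · simpa only [flipAt_apply_of_ne x hkq] using hne k

lemma card_syndrome_flipAt_eq_zero [DecidableEq V] (h : IsHalfSystem p) (hs : syndrome p x ≠ 0)
    (hx : IsNear p x) : #{i | syndrome p (flipAt x i) = 0} = 1 := by
  obtain ⟨i, hi⟩ := hx.resolve_left hs
  refine card_eq_one.2 ⟨i, ?_⟩
  ext j
  rw [mem_filter_univ, mem_singleton]
  refine ⟨fun hj => (h.sgn_smul x).1 ?_, by rintro rfl; exact hi⟩
  rw [syndrome_flipAt] at hi hj
  exact add_left_cancel (hj.trans hi.symm)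

end IsHalfSystem

namespace IsHalfSystem

variable {V : Type*} [AddCommGroup V] [Module (ZMod 3) V] {p : Fin 13 → V} {x : Word 13}
  {a b : Module.Dual (ZMod 3) V}

lemma card_isNear_flipAt_of_isNear [DecidableEq V] (h : IsHalfSystem p) (hs : syndrome p x ≠ 0)
    (hx : IsNear p x) : #{i | IsNear p (flipAt x i)} = 7 := by
  have hne := h.isNear_iff.1 hx
  simp only [h.isNear_flipAt_iff hs, hne, ne_eq, not_false_eq_true, and_true]
  refine ((h.sgn_smul x).card_forall_ne_add_sum hs).resolve_right fun ⟨_, ⟨i, hi⟩, _⟩ => hne i hi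

lemma three_le_cubeDist (h : IsHalfSystem p) (ha : a ≠ 0) (hx : syndrome p x = 0) :
    3 ≤ cubeDist (dualWord p a) x := by
  classical
  have hmem (y : Word 13) : y ∈ ({y | syndrome p y = 0} : Finset (Word 13)) ↔ syndrome p y = 0 :=
    mem_filter_univ y
  refine three_le_cubeDist_of_dvd (Z := {y | syndrome p y = 0}) ?_ ?_ ?_ ?_ ((hmem x).2 hx)
  · have hcard : 0 < #{i | dualWord p a i = 0} := by
      rw [h.card_dualWord_eq_zero ha]
      norm_num
    obtain ⟨i, hi⟩ := card_pos.1 hcard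
    exact ⟨i, (mem_filter.1 hi).2⟩
  · simp only [hmem]
    exact fun y hy i => h.syndrome_flipAt_ne_zero hy i
  · simp only [hmem]
    intro y hy i
    rw [h.card_dualWord_eq_zero ha]
    refine (by norm_num : 4 < 7).trans_eq
      (h.card_isNear_flipAt_of_isNear (h.syndrome_flipAt_ne_zero hy i) (.inr ⟨i, ?_⟩)).symm
    rwa [flipAt_flipAt]
  · simp only [hmem]
    intro y hy
    rw [← sum_mul_sgn_eq_zero_iff (by rw [h.hammingNorm_dualWord ha]; norm_num)]
    have := congrArg a hy
    simpa [syndrome, dualWord, mul_comm] using this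

lemma not_isNear_of_mem_subcube (h : IsHalfSystem p) (ha : a ≠ 0)
    (hx : x ∈ subcube (dualWord p a)) : ¬IsNear p x := by
  rw [← cubeDist_eq_zero] at hx
  rintro (hs | ⟨i, hi⟩)
  · have := h.three_le_cubeDist ha hs
    lia
  · have := h.three_le_cubeDist ha hi
    have := cubeDist_flipAt_le (dualWord p a) x i
    lia

lemma not_isNear_flipAt_of_mem_subcube (h : IsHalfSystem p) (ha : a ≠ 0)
    (hx : x ∈ subcube (dualWord p a)) (i : Fin 13) : ¬IsNear p (flipAt x i) := by
  rw [← cubeDist_eq_zero] at hx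
  have hi := cubeDist_flipAt_le (dualWord p a) x i
  rintro (hs | ⟨j, hj⟩)
  · have := h.three_le_cubeDist ha hs
    lia
  · have := h.three_le_cubeDist ha hj
    have := cubeDist_flipAt_le (dualWord p a) (flipAt x i) j
    lia

lemma eq_of_mem_subcube (h : IsHalfSystem p) (ha : a ≠ 0) (hb : b ≠ 0) {y : Word 13}
    (hx : x ∈ subcube (dualWord p a)) (hy : y ∈ subcube (dualWord p b))
    (hxy : hammingDist x y ≤ 2) : a = b := by
  by_contra hab
  have := h.three_le_conflict_dualWord ha hb hab
  have := conflict_le_hammingDist hx hy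
  lia

/-- A word `x` with syndrome `s` lies in the subcube of `dualWord p a` iff `a` does not take the
value `-1` on the vectors `sgn (x i) • p i`, whose sum is `s`. -/
lemma card_isNear_flipAt_of_not_isNear [DecidableEq V] (h : IsHalfSystem p) (hx : ¬IsNear p x)
    (hcube : ∀ a ≠ 0, x ∉ subcube (dualWord p a)) : #{i | IsNear p (flipAt x i)} = 6 := by
  have hs : syndrome p x ≠ 0 := fun hs => hx (.inl hs)
  have hv := h.sgn_smul x
  obtain ⟨i, hi⟩ : ∃ i, sgn (x i) • p i = syndrome p x := by
    simpa using mt h.isNear_iff.2 hx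
  have hcard : #{q | ∀ k, sgn (x k) • p k ≠ sgn (x q) • p q + syndrome p x} = 7 := by
    refine (hv.card_forall_ne_add_sum hs).resolve_right fun ⟨_, _, a, ha, hne⟩ =>
      hcube a ha (mem_subcube.2 fun j hj => ?_)
    have hterm (t : ZMod 3) (b : Fin 2) (ht : t ≠ 0) (hb : sgn b * t ≠ -1) : sgn b = t := by
      decide +revert
    exact hterm _ _ hj (by simpa [dualWord] using hne j)
  have herase : ({q | IsNear p (flipAt x q)} : Finset (Fin 13)) =
      ({q | ∀ k, sgn (x k) • p k ≠ sgn (x q) • p q + syndrome p x} : Finset (Fin 13)).erase i := by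
    ext q
    rw [mem_erase, mem_filter_univ, mem_filter_univ, h.isNear_flipAt_iff hs, ← hi, hv.1.ne_iff,
      and_comm]
  rw [herase, card_erase_of_mem, hcard]
  refine mem_filter.2 ⟨mem_univ i, fun k hk => ?_⟩
  rw [← hi, ← neg_eq_add_self] at hk
  exact hv.ne_neg k i hk

end IsHalfSystem

section HammingCell

open Classical in
/-- The four cells of the words: syndrome `0`, distance `1` to the previous ones, everything else,
and the subcubes of the simplex code. -/
noncomputable def hammingCell {V : Type*} [AddCommGroup V] [Module (ZMod 3) V] (p : Fin 13 → V)
    (x : Word 13) : Fin 4 :=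
  if syndrome p x = 0 then 0 else if IsNear p x then 1 else
    if ∃ a ≠ 0, x ∈ subcube (dualWord p a) then 3 else 2

variable {V : Type*} [AddCommGroup V] [Module (ZMod 3) V] {p : Fin 13 → V} {x : Word 13}

lemma hammingCell_eq_zero_iff : hammingCell p x = 0 ↔ syndrome p x = 0 := by
  unfold hammingCell
  split_ifs with hs <;> simp [hs]

namespace IsHalfSystem

lemma hammingCell_le_one_iff : hammingCell p x ≤ 1 ↔ IsNear p x := by
  unfold hammingCell
  split_ifs with hs hx
  · exact iff_of_true (by decide) (.inl hs)
  · exact iff_of_true le_rfl hx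
  · exact iff_of_false (by decide) hx
  · exact iff_of_false (by decide) hx

lemma hammingCell_eq_three_iff (h : IsHalfSystem p) :
    hammingCell p x = 3 ↔ ∃ a ≠ 0, x ∈ subcube (dualWord p a) := by
  have hnear : (∃ a ≠ 0, x ∈ subcube (dualWord p a)) → ¬IsNear p x := fun ⟨_, ha, hx⟩ =>
    h.not_isNear_of_mem_subcube ha hx
  unfold hammingCell
  split_ifs with hs hx ha
  · exact iff_of_false (by decide) fun ha => hnear ha (.inl hs)
  · exact iff_of_false (by decide) fun ha => hnear ha hx
  · exact iff_of_true rfl ha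
  · exact iff_of_false (by decide) ha

lemma card_flipAt_eq_of_card_isNear [DecidableEq V] {k : Fin 4}
    (h0 : #{i | syndrome p (flipAt x i) = 0} = quotientMatrix k 0)
    (h1 : #{i | IsNear p (flipAt x i)} = quotientMatrix k 0 + quotientMatrix k 1)
    (h3 : #{i | hammingCell p (flipAt x i) = 3} = quotientMatrix k 3) (j : Fin 4) :
    #{i | hammingCell p (flipAt x i) = j} = quotientMatrix k j := by
  simp only [← hammingCell_eq_zero_iff] at h0
  simp only [← hammingCell_le_one_iff] at h1
  have hle (m : Fin 4) : (if m ≤ 1 then 1 else 0) = (if m = 0 then 1 else 0) +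
      if m = 1 then 1 else 0 := by decide +revert
  simp only [card_filter, hle, sum_add_distrib] at h1
  simp only [← card_filter] at h1
  have hsum : ∑ m, #{i | hammingCell p (flipAt x i) = m} = 13 := by
    rw [← card_eq_sum_card_fiberwise fun i _ => mem_univ _]
    rfl
  have hrow : ∑ m, quotientMatrix k m = 13 := by
    clear * -
    decide +revert
  rw [Fin.sum_univ_four] at hsum hrow
  fin_cases j <;> simp only [Fin.zero_eta, Fin.mk_one, Fin.reduceFinMk] <;> lia

lemma card_flipAt_eq_three_of_isNear (h : IsHalfSystem p) (hx : IsNear p x) :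
    #{i | hammingCell p (flipAt x i) = 3} = 0 := by
  refine card_eq_zero.2 (filter_eq_empty_iff.2 fun i _ hi => ?_)
  obtain ⟨a, ha, hcube⟩ := h.hammingCell_eq_three_iff.1 hi
  refine h.not_isNear_flipAt_of_mem_subcube ha hcube i ?_
  rwa [flipAt_flipAt]

lemma card_flipAt_of_eq_zero (h : IsHalfSystem p) (hx : hammingCell p x = 0) (j : Fin 4) :
    #{i | hammingCell p (flipAt x i) = j} = quotientMatrix 0 j := by
  classical
  rw [hammingCell_eq_zero_iff] at hx
  refine card_flipAt_eq_of_card_isNear ?_ ?_ (h.card_flipAt_eq_three_of_isNear (.inl hx)) j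
  · exact card_eq_zero.2 (filter_eq_empty_iff.2 fun i _ => h.syndrome_flipAt_ne_zero hx i)
  · have hnear (i : Fin 13) : IsNear p (flipAt x i) := .inr ⟨i, by rwa [flipAt_flipAt]⟩
    simp only [hnear, filter_true, card_univ, Fintype.card_fin]
    rfl

lemma card_flipAt_of_eq_one (h : IsHalfSystem p) (hx : hammingCell p x = 1) (j : Fin 4) :
    #{i | hammingCell p (flipAt x i) = j} = quotientMatrix 1 j := by
  classical
  have hs : syndrome p x ≠ 0 := by
    rw [ne_eq, ← hammingCell_eq_zero_iff, hx]
    decide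
  have hnear : IsNear p x := hammingCell_le_one_iff.1 hx.le
  exact card_flipAt_eq_of_card_isNear (h.card_syndrome_flipAt_eq_zero hs hnear)
    (h.card_isNear_flipAt_of_isNear hs hnear) (h.card_flipAt_eq_three_of_isNear hnear) j

lemma card_flipAt_of_eq_three (h : IsHalfSystem p) (hx : hammingCell p x = 3) (j : Fin 4) :
    #{i | hammingCell p (flipAt x i) = j} = quotientMatrix 3 j := by
  classical
  obtain ⟨a, ha, hcube⟩ := h.hammingCell_eq_three_iff.1 hx
  have hfar := h.not_isNear_flipAt_of_mem_subcube ha hcube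
  refine card_flipAt_eq_of_card_isNear ?_ ?_ ?_ j
  · exact card_eq_zero.2 (filter_eq_empty_iff.2 fun i _ hi => hfar i (.inl hi))
  · exact card_eq_zero.2 (filter_eq_empty_iff.2 fun i _ => hfar i)
  · refine (congrArg card (filter_congr fun i _ => ?_)).trans (h.card_dualWord_eq_zero ha)
    rw [h.hammingCell_eq_three_iff, ← flipAt_mem_subcube_iff hcube]
    refine ⟨fun ⟨b, hb, hi⟩ => ?_, fun hi => ⟨a, ha, hi⟩⟩
    rwa [h.eq_of_mem_subcube ha hb hcube hi (by simp [hammingDist_flipAt])]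

lemma card_flipAt_eq_three_le_one (h : IsHalfSystem p) (hx : hammingCell p x ≠ 3) :
    #{i | hammingCell p (flipAt x i) = 3} ≤ 1 := by
  refine card_le_one.2 fun i hi j hj => ?_
  rw [mem_filter_univ, h.hammingCell_eq_three_iff] at hi hj
  obtain ⟨a, ha, hi⟩ := hi
  obtain ⟨b, hb, hj⟩ := hj
  have hdist : hammingDist (flipAt x i) (flipAt x j) ≤ 2 := by
    refine (hammingDist_triangle _ x _).trans_eq ?_
    rw [hammingDist_comm, hammingDist_flipAt, hammingDist_flipAt]
  obtain rfl := h.eq_of_mem_subcube ha hb hi hj hdist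
  exact eq_of_flipAt_mem_subcube (fun hcube => hx (h.hammingCell_eq_three_iff.2 ⟨a, ha, hcube⟩))
    hi hj

lemma card_isNear_flipAt_of_eq_two [DecidableEq V] (h : IsHalfSystem p)
    (hx : hammingCell p x = 2) : #{i | IsNear p (flipAt x i)} = 6 := by
  refine h.card_isNear_flipAt_of_not_isNear (fun hnear => ?_) fun a ha hcube => ?_
  · rw [← hammingCell_le_one_iff, hx] at hnear
    exact absurd hnear (by decide)
  · have := h.hammingCell_eq_three_iff.2 ⟨a, ha, hcube⟩
    exact absurd (hx.symm.trans this) (by decide)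

lemma syndrome_flipAt_ne_zero_of_eq_two (hx : hammingCell p x = 2) (i : Fin 13) :
    syndrome p (flipAt x i) ≠ 0 := by
  intro hi
  have hnear : IsNear p x := .inr ⟨i, hi⟩
  rw [← hammingCell_le_one_iff, hx] at hnear
  exact absurd hnear (by decide)

lemma card_flipAt_eq_one_of_eq_two (h : IsHalfSystem p) (hx : hammingCell p x = 2) :
    #{i | hammingCell p (flipAt x i) = 1} = 6 := by
  classical
  rw [← h.card_isNear_flipAt_of_eq_two hx]
  refine congrArg card (filter_congr fun i _ => ?_)
  have hne := syndrome_flipAt_ne_zero_of_eq_two hx i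
  rw [ne_eq, ← hammingCell_eq_zero_iff] at hne
  rw [← hammingCell_le_one_iff]
  generalize hammingCell p (flipAt x i) = k at hne
  clear * - hne
  decide +revert

lemma card_eq_three (h : IsHalfSystem p) : #{x | hammingCell p x = 3} = 416 := by
  classical
  have : Finite (Module.Dual (ZMod 3) V) :=
    Nat.finite_of_card_ne_zero (by rw [h.natCard_dual]; norm_num)
  have := Fintype.ofFinite (Module.Dual (ZMod 3) V)
  have hunion : ({x | hammingCell p x = 3} : Finset (Word 13)) =
      (univ.erase 0).biUnion fun a : Module.Dual (ZMod 3) V => subcube (dualWord p a) := by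
    ext x
    simp [h.hammingCell_eq_three_iff]
  rw [hunion, card_biUnion]
  · rw [sum_const_nat (m := 16) fun a ha => by
      rw [card_subcube, h.card_dualWord_eq_zero (ne_of_mem_erase ha)]; rfl,
      card_erase_of_mem (mem_univ _), card_univ, ← Nat.card_eq_fintype_card, h.natCard_dual]
  · refine fun a ha b hb hab => disjoint_left.2 fun x hxa hxb => hab ?_
    exact h.eq_of_mem_subcube (ne_of_mem_erase ha) (ne_of_mem_erase hb) hxa hxb (by simp)

lemma card_eq_two (h : IsHalfSystem p) : #{x | hammingCell p x = 2} = 3744 := by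
  have h01 : _ * 13 = _ * 1 :=
    card_mul_eq_card_mul (fun x (hx : hammingCell p x = 0) => h.card_flipAt_of_eq_zero hx 1)
      fun x hx => h.card_flipAt_of_eq_one hx 0
  have h12 : _ * 6 = _ * 6 :=
    card_mul_eq_card_mul (fun x (hx : hammingCell p x = 1) => h.card_flipAt_of_eq_one hx 2)
      fun x hx => h.card_flipAt_eq_one_of_eq_two hx
  have htotal := sum_card_fiber (hammingCell p)
  rw [Fin.sum_univ_four, h.card_eq_three] at htotal
  lia

lemma card_flipAt_eq_three_of_eq_two (h : IsHalfSystem p) (hx : hammingCell p x = 2) :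
    #{i | hammingCell p (flipAt x i) = 3} = 1 := by
  have hle (y : Word 13) (hy : y ∈ ({y | hammingCell p y = 2} : Finset (Word 13))) :
      #{i | hammingCell p (flipAt y i) = 3} ≤ 1 :=
    h.card_flipAt_eq_three_le_one (by rw [(mem_filter.1 hy).2]; decide)
  refine (sum_eq_sum_iff_of_le hle).1 ?_ x (mem_filter.2 ⟨mem_univ x, hx⟩)
  rw [sum_card_flipAt (hammingCell p · = 2) (hammingCell p · = 3),
    sum_const_nat fun y hy => h.card_flipAt_of_eq_three (mem_filter.1 hy).2 2, h.card_eq_three,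
    sum_const, h.card_eq_two]
  rfl

lemma card_flipAt_of_eq_two (h : IsHalfSystem p) (hx : hammingCell p x = 2) (j : Fin 4) :
    #{i | hammingCell p (flipAt x i) = j} = quotientMatrix 2 j := by
  classical
  refine card_flipAt_eq_of_card_isNear ?_ (h.card_isNear_flipAt_of_eq_two hx)
    (h.card_flipAt_eq_three_of_eq_two hx) j
  exact card_eq_zero.2 (filter_eq_empty_iff.2 fun i _ => syndrome_flipAt_ne_zero_of_eq_two hx i)

theorem isEquitable_hammingCell (h : IsHalfSystem p) :
    IsEquitable quotientMatrix (hammingCell p) := by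
  intro x j
  generalize hx : hammingCell p x = k
  match k with
  | 0 => exact h.card_flipAt_of_eq_zero hx j
  | 1 => exact h.card_flipAt_of_eq_one hx j
  | 2 => exact h.card_flipAt_of_eq_two hx j
  | 3 => exact h.card_flipAt_of_eq_three hx j

theorem isCRCode (h : IsHalfSystem p) :
    IsCRCode (hammingGraph 13 2) ![13, 6, 1] ![1, 6, 9] {x | syndrome p x = 0} := by
  simpa only [hammingCell_eq_zero_iff] using h.isEquitable_hammingCell.isCRCode_zero

end IsHalfSystem

end HammingCell

section SubcubeWalks

variable {n m : ℕ}

lemma subcube_induction {t : Fin n → ZMod 3} {P : Word n → Prop} {x y : Word n}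
    (hx : x ∈ subcube t) (hy : y ∈ subcube t) (hPy : P y)
    (hflip : ∀ z ∈ subcube t, P z → ∀ i, t i = 0 → P (flipAt z i)) : P x := by
  suffices hA : ∀ A : Finset (Fin n), A.piecewise x y ∈ subcube t ∧ P (A.piecewise x y) by
    simpa using (hA univ).2
  intro A
  induction A using Finset.induction with
  | empty => simpa using ⟨hy, hPy⟩
  | insert i A hi ih =>
    rw [piecewise_insert]
    set z := A.piecewise x y
    have hzi : z i = y i := piecewise_eq_of_notMem A x y hi
    obtain hxi | hxi := eq_or_ne (x i) (z i)
    · rwa [hxi, Function.update_eq_self]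
    have hti : t i = 0 := by
      by_contra hti
      rw [hzi] at hxi
      exact hxi (sgn_injective ((mem_subcube.1 hx i hti).trans (mem_subcube.1 hy i hti).symm))
    have hupdate : Function.update z i (x i) = flipAt z i := by
      ext1 j
      obtain rfl | hji := eq_or_ne j i
      · rw [Function.update_self, flipAt_apply_self, fin_two_eq_add_one hxi]
      · rw [Function.update_of_ne hji, flipAt_apply_of_ne z hji]
    rw [hupdate]
    exact ⟨(flipAt_mem_subcube_iff ih.1).2 hti, hflip z ih.1 ih.2 i hti⟩

lemma card_cubeDist_flipAt_eq (t : Fin n → ZMod 3) (x : Word n) (d : ℕ) :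
    #{i | cubeDist t (flipAt x i) = d} = (if cubeDist t x = d then #{i | t i = 0} else 0) +
      (if cubeDist t x + 1 = d then hammingNorm t - cubeDist t x else 0) +
      if cubeDist t x = d + 1 then cubeDist t x else 0 := by
  have hdir (i : Fin n) : (if cubeDist t (flipAt x i) = d then 1 else 0) =
      (if t i = 0 then 1 else 0) * (if cubeDist t x = d then 1 else 0) +
      (if t i ≠ 0 ∧ sgn (x i) = t i then 1 else 0) * (if cubeDist t x + 1 = d then 1 else 0) +
      (if t i ≠ 0 ∧ sgn (x i) ≠ t i then 1 else 0) * if cubeDist t x = d + 1 then 1 else 0 := by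
    have hflip := cubeDist_flipAt_add t x i
    by_cases hi : t i = 0
    · simp_all
    · by_cases hx : sgn (x i) = t i
      · simp_all
      · have hdist : cubeDist t x = cubeDist t (flipAt x i) + 1 := by simp_all
        simp [hi, hx, hdist]
  have hagree : #{i | t i ≠ 0 ∧ sgn (x i) = t i} = hammingNorm t - cubeDist t x := by
    have := cubeDist_add_card_agree t x
    lia
  rw [card_filter, sum_congr rfl fun i _ => hdir i, sum_add_distrib, sum_add_distrib, ← sum_mul,
    ← sum_mul, ← sum_mul, ← card_filter, ← card_filter, ← card_filter, hagree, ← cubeDist]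
  simp only [mul_ite, mul_one, mul_zero]

lemma IsEquitable.shell_recurrence {S : Matrix (Fin m) (Fin m) ℕ} {c : Word n → Fin m}
    (h : IsEquitable S c) (t : Fin n → ZMod 3) (d : ℕ) (j : Fin m) :
    ∑ k, #{x | cubeDist t x = d ∧ c x = k} * S k j =
      #{i | t i = 0} * #{x | cubeDist t x = d ∧ c x = j} +
      (hammingNorm t + 1 - d) * #{x | cubeDist t x + 1 = d ∧ c x = j} +
      (d + 1) * #{x | cubeDist t x = d + 1 ∧ c x = j} := by
  have hcount : ∑ x with cubeDist t x = d, #{i | c (flipAt x i) = j} =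
      ∑ x with c x = j, #{i | cubeDist t (flipAt x i) = d} :=
    sum_card_flipAt (cubeDist t · = d) (c · = j)
  have hcells : ∑ x with cubeDist t x = d, #{i | c (flipAt x i) = j} =
      ∑ k, #{x | cubeDist t x = d ∧ c x = k} * S k j := by
    rw [← sum_fiberwise _ c]
    refine sum_congr rfl fun k _ => ?_
    rw [filter_filter]
    exact sum_const_nat fun x hx => (mem_filter.1 hx).2.2 ▸ h x j
  have hmul (a k l : ℕ) : a * #{x | cubeDist t x + k = l ∧ c x = j} =
      ∑ x with c x = j, if cubeDist t x + k = l then a else 0 := by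
    rw [← sum_filter, filter_filter, sum_const, smul_eq_mul, mul_comm]
    simp only [and_comm]
  rw [← hcells, hcount]
  refine Eq.trans ?_ (congrArg₂ (· + ·) (congrArg₂ (· + ·) (hmul _ 0 d) (hmul _ 1 d))
    (hmul _ 0 (d + 1))).symm
  simp only [← sum_add_distrib, add_zero]
  refine sum_congr rfl fun x _ => ?_
  rw [card_cubeDist_flipAt_eq]
  congr 1
  · congr 1
    exact if_ctx_congr Iff.rfl (fun hd => by lia) fun _ => rfl
  · exact if_ctx_congr Iff.rfl id fun _ => rfl

end SubcubeWalks

/-- The ternary word of a subcube of dimension 4 that lies in the last cell. -/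
def IsCube (c : Word 13 → Fin 4) (t : Fin 13 → ZMod 3) : Prop :=
  hammingNorm t = 9 ∧ ∀ x ∈ subcube t, c x = 3

/-- The ternary word of the subcube through `y` whose free directions are those in which the
neighbor of `y` lies in the last cell. -/
def cubeWord (c : Word 13 → Fin 4) (y : Word 13) (i : Fin 13) : ZMod 3 :=
  if c (flipAt y i) = 3 then 0 else sgn (y i)

/-- The number of words at distance `d` from a subcube of dimension 4 of the last cell that lie in
the cell `j`. -/
def shellSize : Fin 10 → Fin 4 → ℕ :=
  ![![0, 0, 0, 16], ![0, 0, 144, 0], ![0, 432, 144, 0], ![144, 576, 576, 48], ![0, 864, 1008, 144],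
    ![0, 864, 1008, 144], ![144, 576, 576, 48], ![0, 432, 144, 0], ![0, 0, 144, 0], ![0, 0, 0, 16]]

section Cubes

variable {c : Word 13 → Fin 4} {t s : Fin 13 → ZMod 3} {x y : Word 13}

lemma cubeWord_eq_zero {i : Fin 13} : cubeWord c y i = 0 ↔ c (flipAt y i) = 3 := by
  simp [cubeWord, sgn_ne_zero]

lemma mem_subcube_cubeWord (c : Word 13 → Fin 4) (y : Word 13) : y ∈ subcube (cubeWord c y) := by
  refine mem_subcube.2 fun i hi => ?_
  rw [cubeWord, if_neg (mt cubeWord_eq_zero.2 hi)]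

namespace IsCube

lemma card_eq_zero (ht : IsCube c t) : #{i | t i = 0} = 4 := by
  have := card_zeros_add_hammingNorm t
  rw [ht.1] at this
  lia

lemma card_subcube (ht : IsCube c t) : #(subcube t) = 16 := by
  rw [CRCode.card_subcube, ht.card_eq_zero]
  rfl

lemma card_cubeDist_eq_zero (ht : IsCube c t) (j : Fin 4) :
    #{x | cubeDist t x = 0 ∧ c x = j} = (![0, 0, 0, 16] : Fin 4 → ℕ) j := by
  have hcell (x : Word 13) : x ∈ subcube t ∧ c x = j ↔ x ∈ subcube t ∧ 3 = j :=
    and_congr_right fun hx => by rw [ht.2 x hx]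
  simp only [cubeDist_eq_zero, hcell]
  have := ht.card_subcube
  fin_cases j <;> simp [this]

lemma ne_zero (ht : IsCube c t) : t ≠ 0 := by
  rintro rfl
  simpa using ht.1

lemma ne_neg (ht : IsCube c t) : t ≠ -t := fun heq => ht.ne_zero <| funext fun i =>
  (by decide : ∀ a : ZMod 3, a = -a → a = 0) _ (congrFun heq i)

end IsCube

namespace IsEquitable

lemma flipAt_flipAt_eq_three (h : IsEquitable quotientMatrix c) {i j : Fin 13}
    (hi : c (flipAt y i) = 3) (hj : c (flipAt y j) = 3) (hij : i ≠ j) :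
    c (flipAt (flipAt y i) j) = 3 := by
  refine (h.eq_two_or_eq_three hi j).resolve_left fun h2 => hij ?_
  have hcard : #{k | c (flipAt (flipAt (flipAt y i) j) k) = 3} ≤ 1 := by
    rw [h, h2]
    exact le_rfl
  refine card_le_one.1 hcard i ?_ j ?_
  · rw [mem_filter_univ, flipAt_comm y i j, flipAt_flipAt]
    exact hj
  · rw [mem_filter_univ, flipAt_flipAt]
    exact hi

lemma flipAt_flipAt_eq_three_iff (h : IsEquitable quotientMatrix c) (hy : c y = 3) {i : Fin 13}
    (hi : c (flipAt y i) = 3) (j : Fin 13) :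
    c (flipAt (flipAt y i) j) = 3 ↔ c (flipAt y j) = 3 := by
  obtain rfl | hij := eq_or_ne i j
  · rw [flipAt_flipAt]
    exact iff_of_true hy hi
  refine ⟨fun hj => ?_, fun hj => h.flipAt_flipAt_eq_three hi hj hij⟩
  have hback := h.flipAt_flipAt_eq_three (y := flipAt y i) hj (by rwa [flipAt_flipAt]) hij.symm
  rwa [flipAt_comm y i j, flipAt_flipAt] at hback

lemma isCube_cubeWord (h : IsEquitable quotientMatrix c) (hy : c y = 3) :
    IsCube c (cubeWord c y) := by
  constructor
  · have hfree : #{i | cubeWord c y i = 0} = 4 := by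
      simp only [cubeWord_eq_zero]
      rw [h, hy]
      rfl
    have := card_zeros_add_hammingNorm (cubeWord c y)
    lia
  · intro x hx
    refine (subcube_induction (P := fun z => c z = 3 ∧ ∀ j, c (flipAt z j) = 3 ↔ c (flipAt y j) = 3)
      hx (mem_subcube_cubeWord c y) ⟨hy, fun j => Iff.rfl⟩ ?_).1
    intro z _ hz i hi
    have hzi : c (flipAt z i) = 3 := (hz.2 i).2 (cubeWord_eq_zero.1 hi)
    exact ⟨hzi, fun j => (h.flipAt_flipAt_eq_three_iff hz.1 hzi j).trans (hz.2 j)⟩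

lemma cubeWord_eq (h : IsEquitable quotientMatrix c) (ht : IsCube c t) (hy : y ∈ subcube t) :
    cubeWord c y = t := by
  have hsub : ({i | t i = 0} : Finset (Fin 13)) ⊆
      ({i | cubeWord c y i = 0} : Finset (Fin 13)) := fun i hi => by
    rw [mem_filter_univ] at hi ⊢
    exact cubeWord_eq_zero.2 (ht.2 _ ((flipAt_mem_subcube_iff hy).2 hi))
  have hzeros := eq_of_subset_of_card_le hsub
    (by rw [ht.card_eq_zero, (h.isCube_cubeWord (ht.2 y hy)).card_eq_zero])
  ext1 i
  have hi : t i = 0 ↔ cubeWord c y i = 0 := by simpa using congrArg (i ∈ ·) hzeros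
  obtain h0 | h0 := eq_or_ne (t i) 0
  · rw [h0, hi.1 h0]
  · rw [← mem_subcube.1 hy i h0, mem_subcube.1 (mem_subcube_cubeWord c y) i (mt hi.2 h0)]

lemma filter_cubeWord_eq (h : IsEquitable quotientMatrix c) (ht : IsCube c t) :
    ({y | c y = 3 ∧ cubeWord c y = t} : Finset (Word 13)) = subcube t := by
  ext y
  rw [mem_filter_univ]
  refine ⟨?_, fun hy => ⟨ht.2 y hy, h.cubeWord_eq ht hy⟩⟩
  rintro ⟨-, rfl⟩
  exact mem_subcube_cubeWord c y

lemma card_cubeDist_eq (h : IsEquitable quotientMatrix c) (ht : IsCube c t) (d : Fin 10) :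
    (fun j => #{x | cubeDist t x = d ∧ c x = j}) = shellSize d := by
  have hrec (d : ℕ) (j : Fin 4) := h.shell_recurrence t d j
  simp only [ht.1, ht.card_eq_zero] at hrec
  set N : ℕ → Fin 4 → ℕ := fun d j => #{x | cubeDist t x = d ∧ c x = j}
  have h0 : N 0 = ![0, 0, 0, 16] := funext ht.card_cubeDist_eq_zero
  have h1 : N 1 = ![0, 0, 144, 0] := by
    have hr : ∀ j, ∑ k, (![0, 0, 0, 16] : Fin 4 → ℕ) k * quotientMatrix k j =
        4 * ![0, 0, 0, 16] j + ![0, 0, 144, 0] j := by decide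
    ext1 j
    have hj : ∑ k, N 0 k * quotientMatrix k j = 4 * N 0 j + N 1 j := by simpa using hrec 0 j
    rw [h0, hr] at hj
    exact (Nat.add_left_cancel hj).symm
  have hstep {d : ℕ} {a b : Fin 4 → ℕ} (ha : N d = a) (hb : N (d + 1) = b) {r : Fin 4 → ℕ}
      (hr : ∀ j, ∑ k, b k * quotientMatrix k j = 4 * b j + (9 - d) * a j + (d + 2) * r j) :
      N (d + 2) = r := by
    ext1 j
    have hj : ∑ k, N (d + 1) k * quotientMatrix k j =
        4 * N (d + 1) j + (9 - d) * N d j + (d + 2) * N (d + 2) j := by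
      simpa using hrec (d + 1) j
    rw [ha, hb, hr] at hj
    exact (Nat.eq_of_mul_eq_mul_left (Nat.succ_pos _) (Nat.add_left_cancel hj)).symm
  have h2 : N 2 = ![0, 432, 144, 0] := hstep h0 h1 (by decide)
  have h3 : N 3 = ![144, 576, 576, 48] := hstep h1 h2 (by decide)
  have h4 : N 4 = ![0, 864, 1008, 144] := hstep h2 h3 (by decide)
  have h5 : N 5 = ![0, 864, 1008, 144] := hstep h3 h4 (by decide)
  have h6 : N 6 = ![144, 576, 576, 48] := hstep h4 h5 (by decide)
  have h7 : N 7 = ![0, 432, 144, 0] := hstep h5 h6 (by decide)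
  have h8 : N 8 = ![0, 0, 144, 0] := hstep h6 h7 (by decide)
  have h9 : N 9 = ![0, 0, 0, 16] := hstep h7 h8 (by decide)
  fin_cases d
  exacts [h0, h1, h2, h3, h4, h5, h6, h7, h8, h9]

lemma shellSize_ne_zero (h : IsEquitable quotientMatrix c) (ht : IsCube c t) (x : Word 13) :
    shellSize ⟨cubeDist t x, Nat.lt_succ_of_le (ht.1 ▸ cubeDist_le_hammingNorm t x)⟩ (c x) ≠ 0 := by
  rw [← h.card_cubeDist_eq ht]
  exact card_ne_zero_of_mem (mem_filter.2 ⟨mem_univ x, rfl, rfl⟩)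

lemma three_dvd_cubeDist (h : IsEquitable quotientMatrix c) (ht : IsCube c t) (hx : c x = 0) :
    3 ∣ cubeDist t x := by
  have hne := h.shellSize_ne_zero ht x
  rw [hx] at hne
  exact (by decide : ∀ d : Fin 10, shellSize d 0 ≠ 0 → 3 ∣ d.val) _ hne

lemma three_le_cubeDist (h : IsEquitable quotientMatrix c) (ht : IsCube c t) (hx : c x = 3)
    (hxt : x ∉ subcube t) : 3 ≤ cubeDist t x := by
  have hne := h.shellSize_ne_zero ht x
  rw [hx] at hne
  rw [← cubeDist_eq_zero] at hxt
  exact ((by decide : ∀ d : Fin 10, shellSize d 3 ≠ 0 → d.val = 0 ∨ 3 ≤ d.val) _ hne).resolve_left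
    hxt

lemma isCube_neg (h : IsEquitable quotientMatrix c) (ht : IsCube c t) : IsCube c (-t) := by
  refine ⟨(hammingNorm_neg t).trans ht.1, fun x hx => ?_⟩
  exact (by decide : ∀ (d : Fin 10) j, shellSize d j ≠ 0 → d.val = 9 → j = 3) _ _
    (h.shellSize_ne_zero ht x) ((cubeDist_of_mem_neg hx).trans ht.1)

lemma three_le_conflict (h : IsEquitable quotientMatrix c) (ht : IsCube c t) (hs : IsCube c s)
    (hst : s ≠ t) : 3 ≤ conflict t s := by
  obtain ⟨y, hy, hconflict⟩ := exists_mem_subcube_cubeDist_eq_conflict t s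
  rw [← hconflict]
  exact h.three_le_cubeDist ht (hs.2 y hy) fun hyt =>
    hst ((h.cubeWord_eq hs hy).symm.trans (h.cubeWord_eq ht hyt))

end IsEquitable

end Cubes

section CubeCode

variable {c : Word 13 → Fin 4} {t s u : Fin 13 → ZMod 3} {x : Word 13}

namespace IsEquitable

lemma sum_card_flipAt_flipAt_eq {n m : ℕ} {S : Matrix (Fin m) (Fin m) ℕ} {c : Word n → Fin m}
    (h : IsEquitable S c) (x : Word n) (j : Fin m) :
    ∑ i, #{k | c (flipAt (flipAt x i) k) = j} = (S * S) (c x) j := by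
  rw [Matrix.mul_apply, ← h.sum_comp_flipAt (S · j) x]
  exact sum_congr rfl fun i _ => h (flipAt x i) j

/-- Count the walks of length 3 with first direction `i` from the cell `0` to the cell `3` at both
ends. -/
lemma card_flipAt_ne_three (h : IsEquitable quotientMatrix c) (i : Fin 13) :
    #{y | c y = 3 ∧ c (flipAt y i) ≠ 3} = 288 := by
  have hwalks := sum_mul_sum_sum_flipAt (fun x => if c x = 0 then 1 else 0)
    (fun x => if c x = 3 then 1 else 0) i
  simp only [ite_mul, one_mul, zero_mul, ← sum_filter, ← card_eq_sum_ones,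
    h.sum_card_flipAt_flipAt_eq] at hwalks
  have hzero : ∑ x with c x = 0, (quotientMatrix * quotientMatrix) (c (flipAt x i)) 3 =
      #{x | c x = 0} * 6 := sum_const_nat fun x hx => by
    rw [h.eq_one_of_eq_zero (mem_filter.1 hx).2 i]
    decide
  have hthree : ∑ y with c y = 3, (quotientMatrix * quotientMatrix) (c (flipAt y i)) 0 =
      #{y | c y = 3 ∧ c (flipAt y i) ≠ 3} * 6 := by
    rw [← filter_filter, ← sum_filter_of_ne (p := fun y => c (flipAt y i) ≠ 3)]
    · refine sum_const_nat fun y hy => ?_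
      rw [mem_filter, mem_filter] at hy
      rw [(h.eq_two_or_eq_three hy.1.2 i).resolve_right hy.2]
      decide
    · intro y _ hne hy
      rw [hy] at hne
      exact hne (by decide)
  rw [hzero, hthree, h.card_cells.1] at hwalks
  lia

lemma card_flipAt_eq_three (h : IsEquitable quotientMatrix c) (i : Fin 13) :
    #{y | c y = 3 ∧ c (flipAt y i) = 3} = 128 := by
  have hsplit := card_filter_add_card_filter_not (s := ({y | c y = 3} : Finset (Word 13)))
    (fun y => c (flipAt y i) = 3)
  rw [filter_filter, filter_filter, h.card_flipAt_ne_three, h.card_cells.2.2.2] at hsplit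
  lia

lemma six_le_overlap (h : IsEquitable quotientMatrix c) (ht : IsCube c t) (hs : IsCube c s)
    (hst : s ≠ t) (hst_neg : s ≠ -t) : 6 ≤ overlap t s := by
  have hconflict := h.three_le_conflict ht hs hst
  have hconflict_neg := h.three_le_conflict ht (h.isCube_neg hs) fun heq => hst_neg (by
    rw [← heq, neg_neg])
  rw [← conflict_add_conflict_neg]
  lia

lemma sum_overlap_cubeWord (h : IsEquitable quotientMatrix c) (ht : IsCube c t) :
    ∑ y with c y = 3, overlap t (cubeWord c y) = 2592 := by
  have hcoord (i : Fin 13) : (∑ y with c y = 3, if t i ≠ 0 ∧ cubeWord c y i ≠ 0 then 1 else 0) =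
      if t i ≠ 0 then 288 else 0 := by
    by_cases hi : t i = 0
    · simp [hi]
    · rw [if_pos hi, ← h.card_flipAt_ne_three i, ← card_filter, filter_filter]
      simp [hi, cubeWord_eq_zero]
  simp only [overlap, card_filter]
  rw [sum_comm, sum_congr rfl fun i _ => hcoord i, ← sum_filter, sum_const]
  change hammingNorm t • 288 = 2592
  rw [ht.1]
  rfl

lemma overlap_eq_six (h : IsEquitable quotientMatrix c) (ht : IsCube c t) (hs : IsCube c s)
    (hst : s ≠ t) (hst_neg : s ≠ -t) : overlap t s = 6 := by
  let bound (u : Fin 13 → ZMod 3) : ℕ :=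
    6 + ((if u = t then 3 else 0) + if u = -t then 3 else 0)
  have hbound : ∀ y ∈ ({y | c y = 3} : Finset (Word 13)),
      bound (cubeWord c y) ≤ overlap t (cubeWord c y) := by
    intro y hy
    have hself : overlap t t = 9 ∧ overlap t (-t) = 9 := by
      rw [← ht.1]
      simp [overlap, hammingNorm]
    obtain heq | hne := eq_or_ne (cubeWord c y) t
    · simp [bound, heq, ht.ne_neg, hself]
    obtain heq | hne_neg := eq_or_ne (cubeWord c y) (-t)
    · simp [bound, heq, ht.ne_neg.symm, hself]
    · simpa [bound, hne, hne_neg] using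
        h.six_le_overlap ht (h.isCube_cubeWord (mem_filter.1 hy).2) hne hne_neg
  have hsum : ∑ y with c y = 3, bound (cubeWord c y) = 2592 := by
    simp only [bound, sum_add_distrib, sum_const, ← sum_filter, filter_filter, h.card_cells.2.2.2,
      h.filter_cubeWord_eq ht, h.filter_cubeWord_eq (h.isCube_neg ht), ht.card_subcube,
      (h.isCube_neg ht).card_subcube]
    rfl
  obtain ⟨y, hy⟩ := subcube_nonempty s
  have heq := (sum_eq_sum_iff_of_le hbound).1 (hsum.trans (h.sum_overlap_cubeWord ht).symm) y
    (mem_filter.2 ⟨mem_univ y, hs.2 y hy⟩)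
  rw [h.cubeWord_eq hs hy] at heq
  simpa [bound, hst, hst_neg] using heq.symm

lemma sum_mul_sgn_eq_zero (h : IsEquitable quotientMatrix c) (ht : IsCube c t) (hx : c x = 0) :
    ∑ i, t i * sgn (x i) = 0 :=
  (sum_mul_sgn_eq_zero_iff (by rw [ht.1]; decide) x).2 (h.three_dvd_cubeDist ht hx)

lemma three_le_cubeDist_of_forall_dvd (h : IsEquitable quotientMatrix c) (hu : hammingNorm u = 9)
    (hdvd : ∀ z, c z = 0 → 3 ∣ cubeDist u z) (hx : c x = 0) : 3 ≤ cubeDist u x := by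
  have hzeros : #{i | u i = 0} = 4 := by
    have := card_zeros_add_hammingNorm u
    lia
  refine three_le_cubeDist_of_dvd (Z := {z | c z = 0}) ?_ ?_ ?_ (by simpa using hdvd)
    (mem_filter.2 ⟨mem_univ x, hx⟩)
  · obtain ⟨b, hb⟩ := card_pos.1 (by rw [hzeros]; norm_num : 0 < #{i | u i = 0})
    exact ⟨b, (mem_filter.1 hb).2⟩
  · simp only [mem_filter_univ]
    intro z hz i
    rw [h.eq_one_of_eq_zero hz i]
    decide
  · simp only [mem_filter_univ]
    intro z hz b
    have hsix : #{q | c (flipAt (flipAt z b) q) = 1} = 6 := by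
      rw [h, h.eq_one_of_eq_zero hz b]
      rfl
    refine lt_of_lt_of_le (b := #{q | c (flipAt (flipAt z b) q) = 1})
      (by rw [hzeros, hsix]; norm_num) (card_le_card fun q hq => ?_)
    rw [mem_filter_univ] at hq ⊢
    exact .inr (h.exists_flipAt (by rw [hq]; decide))

lemma isCube_of_forall_dvd (h : IsEquitable quotientMatrix c) (hu : hammingNorm u = 9)
    (hdvd : ∀ z, c z = 0 → 3 ∣ cubeDist u z) : IsCube c u := by
  have hfar0 (z : Word 13) (hz : c z = 0) : 3 ≤ cubeDist u z :=
    h.three_le_cubeDist_of_forall_dvd hu hdvd hz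
  have hfar1 (z : Word 13) (hz : c z = 1) : 2 ≤ cubeDist u z := by
    obtain ⟨k, hk⟩ := h.exists_flipAt (x := z) (j := 0) (by rw [hz]; decide)
    have := hfar0 _ hk
    have := cubeDist_flipAt_le u z k
    lia
  have hfar2 (z : Word 13) (hz : c z = 2) : 1 ≤ cubeDist u z := by
    obtain ⟨k, hk⟩ := h.exists_flipAt (x := z) (j := 1) (by rw [hz]; decide)
    have := hfar1 _ hk
    have := cubeDist_flipAt_le u z k
    lia
  refine ⟨hu, fun x hx => ?_⟩
  rw [← cubeDist_eq_zero] at hx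
  match hk : c x with
  | 0 => exact absurd (hfar0 x hk) (by lia)
  | 1 => exact absurd (hfar1 x hk) (by lia)
  | 2 => exact absurd (hfar2 x hk) (by lia)
  | 3 => rfl

lemma isCube_add (h : IsEquitable quotientMatrix c) (ht : IsCube c t) (hs : IsCube c s)
    (hts : t + s ≠ 0) : IsCube c (t + s) := by
  obtain rfl | hst := eq_or_ne s t
  · have hneg : s + s = -s := funext fun i => (by decide : ∀ a : ZMod 3, a + a = -a) (s i)
    rw [hneg]
    exact h.isCube_neg ht
  have hst_neg : s ≠ -t := fun heq => hts (by rw [heq, add_neg_cancel])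
  have hnorm : hammingNorm (t + s) = 9 := by
    have hconflict := h.three_le_conflict ht hs hst
    have hconflict_neg := h.three_le_conflict ht (h.isCube_neg hs) fun heq => hst_neg (by
      rw [← heq, neg_neg])
    have hsum := conflict_add_conflict_neg t s
    have hadd := hammingNorm_add t s
    rw [h.overlap_eq_six ht hs hst hst_neg] at hsum hadd
    rw [ht.1, hs.1] at hadd
    lia
  refine h.isCube_of_forall_dvd hnorm fun z hz => ?_
  rw [← sum_mul_sgn_eq_zero_iff (by rw [hnorm]; decide)]
  simp only [Pi.add_apply, add_mul, sum_add_distrib, h.sum_mul_sgn_eq_zero ht hz,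
    h.sum_mul_sgn_eq_zero hs hz, add_zero]

/-- The ternary words of the subcubes of dimension 4 of the last cell, together with the zero word,
form a linear code. -/
def cubeCode (h : IsEquitable quotientMatrix c) : Submodule (ZMod 3) (Fin 13 → ZMod 3) where
  carrier := {t | t ≠ 0 → IsCube c t}
  zero_mem' := absurd rfl
  add_mem' {t s} ht hs hts := by
    obtain rfl | ht0 := eq_or_ne t 0
    · rw [zero_add] at hts ⊢
      exact hs hts
    obtain rfl | hs0 := eq_or_ne s 0
    · rw [add_zero]
      exact ht ht0
    exact h.isCube_add (ht ht0) (hs hs0) hts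
  smul_mem' a t ht hat := by
    have ha : a = 1 ∨ a = -1 :=
      (by decide : ∀ a : ZMod 3, a ≠ 0 → a = 1 ∨ a = -1) a (left_ne_zero_of_smul hat)
    have ht := ht (right_ne_zero_of_smul hat)
    rcases ha with rfl | rfl
    · rwa [one_smul]
    · rw [neg_one_smul]
      exact h.isCube_neg ht

lemma natCard_cubeCode (h : IsEquitable quotientMatrix c) : Nat.card h.cubeCode = 27 := by
  classical
  have hfibers := card_eq_sum_card_fiberwise (s := ({y | c y = 3} : Finset (Word 13)))
    (t := ({t | IsCube c t} : Finset (Fin 13 → ZMod 3))) (f := cubeWord c) fun y hy => by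
      simpa using h.isCube_cubeWord (by simpa using hy)
  rw [h.card_cells.2.2.2, sum_const_nat (m := 16) fun t ht => by
    rw [filter_filter, h.filter_cubeWord_eq (mem_filter.1 ht).2,
      (mem_filter.1 ht).2.card_subcube]] at hfibers
  have hzero : (0 : Fin 13 → ZMod 3) ∉ ({t | IsCube c t} : Finset (Fin 13 → ZMod 3)) :=
    fun hmem => (mem_filter.1 hmem).2.ne_zero rfl
  have hcode : (h.cubeCode : Set (Fin 13 → ZMod 3)) =
      (insert 0 ({t | IsCube c t} : Finset (Fin 13 → ZMod 3)) : Finset _) := by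
    ext t
    simp [cubeCode, or_iff_not_imp_left]
  rw [← SetLike.coe_sort_coe, hcode, Nat.card_coe_set_eq, Set.ncard_coe_finset,
    card_insert_of_notMem hzero]
  lia

lemma exists_isCube_apply_ne_zero (h : IsEquitable quotientMatrix c) (i : Fin 13) :
    ∃ t, IsCube c t ∧ t i ≠ 0 := by
  obtain ⟨y, hy⟩ := card_pos.1 (by rw [h.card_flipAt_ne_three i]; norm_num :
    0 < #{y | c y = 3 ∧ c (flipAt y i) ≠ 3})
  obtain ⟨hy, hyi⟩ := (mem_filter.1 hy).2
  exact ⟨cubeWord c y, h.isCube_cubeWord hy, mt cubeWord_eq_zero.1 hyi⟩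

lemma exists_isCube_ne_ne_neg (h : IsEquitable quotientMatrix c) (ht : IsCube c t) (i : Fin 13) :
    ∃ s, IsCube c s ∧ s i = 0 ∧ s ≠ t ∧ s ≠ -t := by
  obtain ⟨y, hy, hyt⟩ := exists_mem_notMem_of_card_lt_card (s := subcube t ∪ subcube (-t))
    (t := ({y | c y = 3 ∧ c (flipAt y i) = 3} : Finset (Word 13))) <| by
      refine (card_union_le _ _).trans_lt ?_
      rw [ht.card_subcube, (h.isCube_neg ht).card_subcube, h.card_flipAt_eq_three]
      norm_num
  obtain ⟨hy, hyi⟩ := (mem_filter.1 hy).2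
  refine ⟨cubeWord c y, h.isCube_cubeWord hy, cubeWord_eq_zero.2 hyi, fun heq => ?_,
    fun heq => ?_⟩
  · exact hyt (mem_union_left _ (heq ▸ mem_subcube_cubeWord c y))
  · exact hyt (mem_union_right _ (heq ▸ mem_subcube_cubeWord c y))

lemma exists_isCube_separating (h : IsEquitable quotientMatrix c) {i j : Fin 13} (hij : i ≠ j) :
    ∃ t, IsCube c t ∧ t i = 0 ∧ t j ≠ 0 := by
  by_contra! hcon
  obtain ⟨y, hy⟩ := card_pos.1 (by rw [h.card_flipAt_eq_three i]; norm_num :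
    0 < #{y | c y = 3 ∧ c (flipAt y i) = 3})
  obtain ⟨hy, hyi⟩ := (mem_filter.1 hy).2
  have ht := h.isCube_cubeWord hy
  have hti : cubeWord c y i = 0 := cubeWord_eq_zero.2 hyi
  obtain ⟨s, hs, hsi, hst, hst_neg⟩ := h.exists_isCube_ne_ne_neg ht i
  have hcommon := card_common_zeros (cubeWord c y) s
  rw [ht.1, hs.1, h.overlap_eq_six ht hs hst hst_neg] at hcommon
  have hone : #{k | cubeWord c y k = 0 ∧ s k = 0} ≤ 1 := by lia
  exact hij (card_le_one.1 hone i (by simp [hti, hsi]) j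
    (by simp [hcon _ ht hti, hcon s hs hsi]))

/-- The coordinate functions of the code of `h`. -/
def coordinate (h : IsEquitable quotientMatrix c) (i : Fin 13) :
    Module.Dual (ZMod 3) h.cubeCode :=
  LinearMap.proj i ∘ₗ h.cubeCode.subtype

lemma isHalfSystem_coordinate (h : IsEquitable quotientMatrix c) :
    IsHalfSystem h.coordinate := by
  have happly {i j : Fin 13} {a : ZMod 3} (hij : h.coordinate i = a • h.coordinate j)
      {t : Fin 13 → ZMod 3} (ht : IsCube c t) : t i = a * t j :=
    LinearMap.congr_fun hij ⟨t, fun _ => ht⟩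
  have hprop {i j : Fin 13} {a : ZMod 3} (hij : h.coordinate i = a • h.coordinate j) : i = j := by
    by_contra hne
    obtain ⟨t, ht, htj, hti⟩ := h.exists_isCube_separating (Ne.symm hne)
    exact hti (by rw [happly hij ht, htj, mul_zero])
  have hzero (i : Fin 13) : h.coordinate i ≠ 0 := fun hi => by
    obtain ⟨t, ht, hti⟩ := h.exists_isCube_apply_ne_zero i
    exact hti (LinearMap.congr_fun hi ⟨t, fun _ => ht⟩)
  have : Finite (Module.Dual (ZMod 3) h.cubeCode) := Module.finite_of_finite (ZMod 3)
  refine .of_card (fun i j hij => hprop (a := 1) (by rwa [one_smul])) (fun i j hij => ?_) hzero ?_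
  · have hij' : h.coordinate i = (-1 : ZMod 3) • h.coordinate j := by
      rw [hij]
      exact (neg_one_smul (ZMod 3) (h.coordinate j)).symm
    obtain ⟨t, ht, hti⟩ := h.exists_isCube_apply_ne_zero i
    have hti_neg := happly hij' ht
    rw [← hprop hij'] at hti_neg
    exact hti ((by decide : ∀ a : ZMod 3, a = -1 * a → a = 0) _ hti_neg)
  · rw [Module.natCard_eq_pow_finrank (K := ZMod 3), Subspace.dual_finrank_eq,
      ← Module.natCard_eq_pow_finrank, h.natCard_cubeCode]
    simp

lemma syndrome_coordinate_eq_zero (h : IsEquitable quotientMatrix c) (hx : c x = 0) :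
    syndrome h.coordinate x = 0 := by
  ext ⟨t, ht⟩
  obtain rfl | ht0 := eq_or_ne t 0
  · exact map_zero (syndrome h.coordinate x)
  have hsum := h.sum_mul_sgn_eq_zero (ht ht0) hx
  simpa [syndrome, coordinate, mul_comm] using hsum

lemma eq_zero_iff_syndrome_coordinate_eq_zero (h : IsEquitable quotientMatrix c) :
    c x = 0 ↔ syndrome h.coordinate x = 0 := by
  classical
  have hsub : ({x | c x = 0} : Finset (Word 13)) ⊆
      ({x | hammingCell h.coordinate x = 0} : Finset (Word 13)) := fun x hx => by
    rw [mem_filter_univ] at hx ⊢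
    exact hammingCell_eq_zero_iff.2 (h.syndrome_coordinate_eq_zero hx)
  have heq := eq_of_subset_of_card_le hsub
    (by rw [h.card_cells.1, h.isHalfSystem_coordinate.isEquitable_hammingCell.card_cells.1])
  rw [← hammingCell_eq_zero_iff]
  simpa using congrArg (x ∈ ·) heq

end IsEquitable

end CubeCode

lemma sgn_add (a b : Fin 2) : sgn (a + b) = sgn a * sgn b := by decide +revert

section Equivalence

variable {n : ℕ} {V V' : Type*} [AddCommGroup V] [AddCommGroup V'] [Module (ZMod 3) V]
  [Module (ZMod 3) V'] {p : Fin n → V} {q : Fin n → V'}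

namespace IsHalfSystem

lemma exists_sgn_smul_eq (h : IsHalfSystem p) {w : V} (hw : w ≠ 0) :
    ∃ j a, w = sgn a • p j := by
  by_cases hmem : w ∈ Set.range p
  · obtain ⟨j, rfl⟩ := hmem
    exact ⟨j, 0, (one_smul (ZMod 3) (p j)).symm⟩
  · obtain ⟨j, hj⟩ := h.2.neg_mem hw hmem
    refine ⟨j, 1, ?_⟩
    rw [hj, show sgn 1 = -1 from rfl, neg_one_smul, neg_neg]

lemma exists_perm_sgn_smul_eq (h : IsHalfSystem p) (hq : IsHalfSystem q)
    (e : V ≃ₗ[ZMod 3] V') :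
    ∃ (π : Equiv.Perm (Fin n)) (a : Fin n → Fin 2), ∀ i, q i = sgn (a i) • e (p (π i)) := by
  choose f a hf using fun i => (h.map e.toAddEquiv).exists_sgn_smul_eq (hq.ne_zero i)
  have hinj : Function.Injective f := fun i j hij => by
    have hi := hf i
    rw [hij] at hi
    obtain ha | ha : sgn (a i) = sgn (a j) ∨ sgn (a i) = -sgn (a j) :=
      (by decide : ∀ a b, sgn a = sgn b ∨ sgn a = -sgn b) (a i) (a j)
    · rw [ha, ← hf j] at hi
      exact hq.1 hi
    · rw [ha, neg_smul, ← hf j] at hi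
      exact absurd hi (hq.ne_neg i j)
  exact ⟨Equiv.ofBijective f (Finite.injective_iff_bijective.1 hinj), a, hf⟩

lemma nonempty_linearEquiv (h : IsHalfSystem p) (hq : IsHalfSystem q) :
    Nonempty (V ≃ₗ[ZMod 3] V') := by
  have := h.finite
  have := hq.finite
  have hcard := h.natCard_eq.trans hq.natCard_eq.symm
  rw [Module.natCard_eq_pow_finrank (K := ZMod 3) (V := V),
    Module.natCard_eq_pow_finrank (K := ZMod 3) (V := V'), Nat.card_zmod] at hcard
  exact ⟨.ofFinrankEq V V' (Nat.pow_right_injective (by simp : 2 ≤ 3) hcard)⟩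

theorem equivalent (h : IsHalfSystem p) (hq : IsHalfSystem q) :
    Equivalent {x : Word n | syndrome p x = 0} {x | syndrome q x = 0} := by
  obtain ⟨e⟩ := h.nonempty_linearEquiv hq
  obtain ⟨π, a, hπ⟩ := h.exists_perm_sgn_smul_eq hq e
  let F : Word n ≃ Word n := (Equiv.arrowCongr π.symm (.refl _)).trans (Equiv.addRight a)
  have hF (x : Word n) : syndrome q (F x) = e (syndrome p x) := by
    rw [syndrome, syndrome, ← Equiv.sum_comp π fun j => sgn (x j) • p j, map_sum]
    refine sum_congr rfl fun i _ => ?_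
    rw [show F x i = x (π i) + a i from rfl, hπ, smul_smul, sgn_add, mul_assoc, sgn_mul_self,
      mul_one, map_smul]
  refine ⟨π, fun i => Equiv.addRight (a i), ?_⟩
  change F '' _ = _
  ext z
  obtain ⟨x, rfl⟩ := F.surjective z
  simp [hF]

end IsHalfSystem

end Equivalence

/-- One vector on each line through `0` of the space of dimension 3 over `ZMod 3`, as the columns of
a parity check matrix of the ternary Hamming code of length 13. -/
def hammingColumn : Fin 13 → Fin 3 → ZMod 3 :=
  ![![1, 0, 0], ![0, 1, 0], ![1, 1, 0], ![2, 1, 0], ![0, 0, 1], ![1, 0, 1], ![2, 0, 1], ![0, 1, 1],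
    ![1, 1, 1], ![2, 1, 1], ![0, 2, 1], ![1, 2, 1], ![2, 2, 1]]

lemma isHalfSystem_hammingColumn : IsHalfSystem hammingColumn :=
  .of_card (by decide) (by decide) (by decide) (by simp)

end CRCode

theorem mainTheorem2 :
    ∃ C : Set (Fin 13 → Fin 2),
      CRCode.IsCRCode (CRCode.hammingGraph 13 2) ![13, 6, 1] ![1, 6, 9] C ∧
      ∀ D : Set (Fin 13 → Fin 2),
        CRCode.IsCRCode (CRCode.hammingGraph 13 2) ![13, 6, 1] ![1, 6, 9] D →
          CRCode.Equivalent C D := by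
  refine ⟨_, CRCode.isHalfSystem_hammingColumn.isCRCode, fun D hD => ?_⟩
  obtain ⟨c, hc, rfl⟩ := hD.exists_isEquitable_quotientMatrix
  simp only [hc.eq_zero_iff_syndrome_coordinate_eq_zero]
  exact CRCode.isHalfSystem_hammingColumn.equivalent hc.isHalfSystem_coordinate
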